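/- There exist a universal constant $C>0$, a positive function $q\mapsto C_q$ and a positive function $(p,q)\mapsto C_{p,q}$ such that the following is true. Let $n\ge 1$ be an integer, let $2<q<\infty$ and $2q/(q-2)<p<\infty$, and let $\mu_1,\dots,\mu_n$ be probability measures on $\mathbb R$. Let $F_i(t)=\mu_i((-\infty,t])$ be the distribution function of $\mu_i$ and let $F_i^{-1}:(0,1)\to\mathbb R$, $F_i^{-1}(s)=\inf\{t\in\mathbb R: F_i(t)\ge s\}$, be its quantile function. Assume that for all $1\le i\le n$ and all $s\in(0,1)$, $$\mathrm{Lip}(F_i^{-1},s)\le \min\{s,1-s\}^{-1-1/q},$$ where $\mathrm{Lip}(T,s)=\lim_{\varepsilon\to0^+}\mathrm{Lip}(T|_{B(s,\varepsilon)})$ is the local Lipschitz constant of $T$ around $s$. Let $f:\mathbb R^n\to\mathbb R$ be differentiable, let $X=(X_1,\dots,X_n)$ have independent coordinates, each $X_i$ with distribution $\mu_i$, and let $\mathbb Mf(X)$ be any median of $f(X)$. Then for all $t>0$, $$\mathbb P\left\{|f(X)-\mathbb Mf(X)|>C_q\,t\,\left|\Big(\sup_{x\in\mathbb R^n}\Big|\frac{\partial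 f}{\partial x_i}(x)\Big|^2\Big)_{i=1}^n\right|_{r,q/2}^{1/2}\right\}\le C\exp(-t^2/2),\qquad r=Ct^2\exp(t^2/q),$$ and $$\mathbb P\left\{|f(X)-\mathbb Mf(X)|>C_{p,q}\,\mathrm{Lip}_p(f)\left(n^{1/2-1/p}\,t+n^{1/q}\,t^2\exp\Big(\frac{t^2}{2q}\Big)\right)\right\}\le C\exp(-t^2/2).$$ Here $|x|_s=(\sum_i|x_i|^s)^{1/s}$ and $\mathrm{Lip}_p(f)=\sup_{x\in\mathbb R^n}|\nabla f(x)|_p\in[0,\infty]$. For $r>0$ and $s>1$, $|x|_{r,s}=\inf\{\lambda>0:x\in\lambda E_{r,s}\}$ is the Minkowski functional of the convex hull $E_{r,s}$ of the set of all vectors $\max\{|u|_1,r|u|_s\}^{-1}u$ with $u\in\{0,1,-1\}^n$, $u\ne0$, and $|x|_{r,s}:=\infty$ if some coordinate of $x$ is infinite. (If the lower bound for the deviation in one of the two events is infinite, that event is empty.) -/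

import Mathlib

open MeasureTheory ProbabilityTheory Set Filter Topology
open scoped ENNReal

noncomputable section

/-- The (best) Lipschitz constant, in `[0, ∞]`, of the restriction of `T` to the set `A`.
Pairs `x = y` contribute `0 / 0 = 0`. -/
def lipConstOn {α β : Type*} [MetricSpace α] [MetricSpace β] (T : α → β) (A : Set α) : ℝ≥0∞ :=
  ⨆ x ∈ A, ⨆ y ∈ A, edist (T x) (T y) / edist x y

/-- The local Lipschitz constant of `T` around `x`: the limit, as `ε → 0⁺`, of the Lipschitz
constant of `T` on the ball of centre `x` and radius `ε`. As that quantity is monotone in `ε`, the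
limit is the infimum (see `tendsto_lipConstOn_ball`). -/
def localLip {α β : Type*} [MetricSpace α] [MetricSpace β] (T : α → β) (x : α) : ℝ≥0∞ :=
  ⨅ ε : ℝ, ⨅ _ : 0 < ε, lipConstOn T (Metric.ball x ε)

theorem lipConstOn_mono {α β : Type*} [MetricSpace α] [MetricSpace β] (T : α → β)
    {A B : Set α} (h : A ⊆ B) : lipConstOn T A ≤ lipConstOn T B :=
  iSup₂_le fun x hx => iSup₂_le fun y hy =>
    le_iSup₂_of_le x (h hx) (le_iSup₂_of_le y (h hy) le_rfl)

theorem tendsto_lipConstOn_ball {α β : Type*} [MetricSpace α] [MetricSpace β] (T : α → β)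
    (x : α) :
    Tendsto (fun ε : ℝ => lipConstOn T (Metric.ball x ε)) (𝓝[>] 0) (𝓝 (localLip T x)) := by
  rw [tendsto_order]
  constructor
  · intro a ha
    filter_upwards [self_mem_nhdsWithin] with ε hε
    exact lt_of_lt_of_le ha (iInf₂_le ε hε)
  · intro a ha
    simp only [localLip, iInf_lt_iff] at ha
    obtain ⟨δ, hδ, hlt⟩ := ha
    filter_upwards [Ioo_mem_nhdsGT hδ] with ε hε
    exact lt_of_le_of_lt (lipConstOn_mono T (Metric.ball_subset_ball hε.2.le)) hlt

/-- The quantile function `F⁻¹ : (0,1) → ℝ`, `F⁻¹ s = inf {t : F t ≥ s}`, where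
`F t = μ (-∞, t]` is the cumulative distribution function of `μ`. -/
def quantileFn (μ : Measure ℝ) : Ioo (0 : ℝ) 1 → ℝ :=
  fun s => sInf {t : ℝ | (s : ℝ) ≤ cdf μ t}

/-- `m` is a median of the real random variable `Y`. -/
def IsMedian {Ω : Type*} [MeasurableSpace Ω] (P : Measure Ω) (Y : Ω → ℝ) (m : ℝ) : Prop :=
  1 / 2 ≤ P {ω | Y ω ≤ m} ∧ 1 / 2 ≤ P {ω | m ≤ Y ω}

/-- The partial derivative `∂f/∂x_i` at `x`. -/
def partialD {n : ℕ} (f : (Fin n → ℝ) → ℝ) (i : Fin n) (x : Fin n → ℝ) : ℝ :=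
  fderiv ℝ f x (Pi.single i 1)

/-- The `ℓ_s^n` norm `|x|_s = (∑ |x_i|^s)^(1/s)`, for a finite exponent `s`. -/
def ellNorm {n : ℕ} (s : ℝ) (x : Fin n → ℝ) : ℝ :=
  (∑ i, |x i| ^ s) ^ (1 / s)

/-- `Lip_s(f) = sup_x |∇f(x)|_s`, an element of `[0, ∞]`. -/
def gradLip {n : ℕ} (s : ℝ) (f : (Fin n → ℝ) → ℝ) : ℝ≥0∞ :=
  ⨆ x : Fin n → ℝ, ENNReal.ofReal (ellNorm s (fun i => partialD f i x))

/-- The vectors `max {|u|_1, r |u|_s}⁻¹ u`, for nonzero `u ∈ {0, 1, -1}^n`. -/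
def signVectors (n : ℕ) (r s : ℝ) : Set (Fin n → ℝ) :=
  {v | ∃ u : Fin n → ℝ, (∀ i, u i = 0 ∨ u i = 1 ∨ u i = -1) ∧ u ≠ 0 ∧
    v = (max (ellNorm 1 u) (r * ellNorm s u))⁻¹ • u}

/-- The norm `|x|_{r,s}`: the Minkowski functional `inf {c > 0 : x ∈ c E}` of the convex hull `E`
of the vectors `max {|u|_1, r |u|_s}⁻¹ u`. -/
def mixedNorm {n : ℕ} (r s : ℝ) (x : Fin n → ℝ) : ℝ :=
  gauge (convexHull ℝ (signVectors n r s)) x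

open Classical in
/-- `|a|_{r,s}` for a vector `a` with entries in `[0, ∞]`; it is `∞` as soon as some entry is. -/
def mixedNormTop {n : ℕ} (r s : ℝ) (a : Fin n → ℝ≥0∞) : ℝ≥0∞ :=
  if ∀ i, a i ≠ ⊤ then ENNReal.ofReal (mixedNorm r s (fun i => (a i).toReal)) else ⊤

/-- The vector `(sup_x |∂f/∂x_i (x)|²)_i`, with entries in `[0, ∞]`. -/
def supSqPartials {n : ℕ} (f : (Fin n → ℝ) → ℝ) : Fin n → ℝ≥0∞ :=
  fun i => ⨆ x : Fin n → ℝ, ENNReal.ofReal (|partialD f i x| ^ 2)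

end

/-! ### Gaussian concentration by the rotation (Maurey–Pisier) method -/

section GaussianConcentration

open scoped NNReal Convolution

/-! Realise X_i as T_i(Z_i), with Z standard Gaussian and T_i = F_i⁻¹ ∘ Φ. The Gaussian tail at z is
at least of order e^{-z²/2}/(1+|z|), so the hypothesis on F_i⁻¹ bounds the slope of T_i at z by a
constant times w(z) = (1+|z|)^{1+1/q} e^{z²/(2q)} (`slopeEnvelope`). Hence f(X) = G(Z), where the
slope of G at Z is at most a constant times (∑ (∂_i f)² w(Z_i)²)^{1/2}.

This is unbounded in general, but it is at most some M on a set K = {∑ c_i w(z_i)^s ≤ 2Λ}. As w^s is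
convex, so is K, and G is M-Lipschitz on K. If K misses mass at most e^{-t²/2}, extending G from K
and applying Gaussian concentration bounds the deviation from the median by (π/2)Mt, up to
probability 10 e^{-t²/2} (`deviation_le_of_slope_le`).

The size of Λ comes from `sum_setLIntegral_slopeEnvelope_le`: for s < q, for an event B of
probability at least e^{-t²/2} and a set A of k indices, the mean of ∑_{i∈A} w(Z_i)^s conditioned on
B is at most C(k + k^{s/q} t^s e^{st²/(2q)}). If the complement of K were more likely than
e^{-t²/2}, taking it as B would contradict the sum exceeding 2Λ there. Conditional means are linear
in c, so bounds for indicator vectors pass to the convex hull that defines |·|_{r,q/2}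
(`sum_abs_mul_le_of_mixedNorm_lt`).

The first inequality takes s = 2 and c_i = sup |∂_i f|². The second takes c_i = 1 and s = 2p/(p-2),
followed by Hölder; the condition p > 2q/(q-2) is exactly s < q. -/

theorem hasDerivAt_comp_rotation {E : Type*} [NormedAddCommGroup E] [InnerProductSpace ℝ E]
    {g : E → ℝ} (hg : ContDiff ℝ 1 g) (p : E × E) (φ : ℝ) :
    HasDerivAt (fun φ : ℝ => g (ContinuousLinearMap.rotation φ p).1)
      (fderiv ℝ g (ContinuousLinearMap.rotation φ p).1 (ContinuousLinearMap.rotation φ p).2) φ := by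
  have h1 : HasDerivAt (fun φ : ℝ => Real.cos φ • p.1 + Real.sin φ • p.2)
      (-Real.sin φ • p.1 + Real.cos φ • p.2) φ :=
    ((Real.hasDerivAt_cos φ).smul_const p.1).add ((Real.hasDerivAt_sin φ).smul_const p.2)
  exact ((hg.differentiable (by norm_num)) _).hasFDerivAt.comp_hasDerivAt φ h1

theorem continuous_rotation_apply {E : Type*} [NormedAddCommGroup E] [InnerProductSpace ℝ E]
    (p : E × E) :
    Continuous (fun φ : ℝ => (ContinuousLinearMap.rotation φ p : E × E)) := by
  simp only [ContinuousLinearMap.rotation_apply]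
  fun_prop

/-- The quarter circle cos φ · p.1 + sin φ · p.2 joins p.1 to p.2, so the increment of g is the
integral of its derivative along that path; Jensen then moves the exponential inside the average
over φ. -/
theorem exp_sub_le_average {E : Type*} [NormedAddCommGroup E] [InnerProductSpace ℝ E]
    {g : E → ℝ} (hg : ContDiff ℝ 1 g) (θ : ℝ) (p : E × E) :
    ENNReal.ofReal (Real.exp (θ * (g p.2 - g p.1))) ≤
      ENNReal.ofReal (2 / Real.pi) * ∫⁻ φ in Ioc (0 : ℝ) (Real.pi / 2),
        ENNReal.ofReal (Real.exp ((θ * (Real.pi / 2)) *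
          fderiv ℝ g (ContinuousLinearMap.rotation φ p).1
            (ContinuousLinearMap.rotation φ p).2)) := by
  have hpi : (0 : ℝ) < Real.pi / 2 := by positivity
  set D : ℝ → ℝ := fun φ => fderiv ℝ g (ContinuousLinearMap.rotation φ p).1
    (ContinuousLinearMap.rotation φ p).2 with hD
  have hDc : Continuous D := by
    have h1 := continuous_rotation_apply p
    exact ((hg.continuous_fderiv (by norm_num)).comp (continuous_fst.comp h1)).clm_apply
      (continuous_snd.comp h1)
  have hftc : ∫ φ in (0 : ℝ)..(Real.pi / 2), D φ = g p.2 - g p.1 := by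
    rw [intervalIntegral.integral_eq_sub_of_hasDerivAt
      (fun φ _ => hasDerivAt_comp_rotation hg p φ) (hDc.intervalIntegrable _ _)]
    simp [ContinuousLinearMap.rotation_apply]
  have hvol : volume.real (Ioc (0 : ℝ) (Real.pi / 2)) = Real.pi / 2 := by
    simp [measureReal_def, hpi.le]
  have hfc : Continuous (fun φ => (θ * (Real.pi / 2)) * D φ) := by fun_prop
  have hec : Continuous (fun φ => Real.exp ((θ * (Real.pi / 2)) * D φ)) := by fun_prop
  have hI : IntegrableOn (fun φ => Real.exp ((θ * (Real.pi / 2)) * D φ)) (Ioc 0 (Real.pi / 2)) :=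
    (hec.integrableOn_Icc).mono_set Ioc_subset_Icc_self
  have hJ := convexOn_exp.map_set_average_le (μ := volume) (t := Ioc (0 : ℝ) (Real.pi / 2))
    (f := fun φ => (θ * (Real.pi / 2)) * D φ) Real.continuous_exp.continuousOn isClosed_univ
    (by simp [hpi]) (by simp) (by simp)
    ((hfc.integrableOn_Icc).mono_set Ioc_subset_Icc_self) hI
  rw [setAverage_eq, setAverage_eq, hvol, integral_const_mul,
    ← intervalIntegral.integral_of_le hpi.le, hftc, smul_eq_mul, smul_eq_mul] at hJ
  have h1 : (Real.pi / 2)⁻¹ * (θ * (Real.pi / 2) * (g p.2 - g p.1)) = θ * (g p.2 - g p.1) := by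
    field_simp
  rw [h1] at hJ
  refine (ENNReal.ofReal_le_ofReal hJ).trans ?_
  rw [inv_div, ENNReal.ofReal_mul (by positivity),
    ofReal_integral_eq_lintegral_ofReal hI (ae_of_all _ fun y => (Real.exp_pos _).le)]

variable {E : Type*} [NormedAddCommGroup E] [InnerProductSpace ℝ E] [FiniteDimensional ℝ E]
  [MeasurableSpace E] [BorelSpace E]

theorem lintegral_exp_dual_stdGaussian (L : StrongDual ℝ E) :
    ∫⁻ y, ENNReal.ofReal (Real.exp (L y)) ∂(stdGaussian E)
      = ENNReal.ofReal (Real.exp (‖L‖ ^ 2 / 2)) := by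
  have hmap : (stdGaussian E).map L = gaussianReal 0 (‖L‖ ^ 2).toNNReal := by
    rw [IsGaussian.map_eq_gaussianReal, variance_dual_stdGaussian,
      integral_strongDual_stdGaussian]
  have hint : Integrable (fun y => Real.exp (L y)) (stdGaussian E) := by
    have h := integrable_exp_mul_gaussianReal (μ := 0) (v := (‖L‖ ^ 2).toNNReal) 1
    rw [← hmap] at h
    have h2 := (integrable_map_measure (by fun_prop) (by fun_prop)).1 h
    simpa [Function.comp_def] using h2
  have hm := mgf_gaussianReal hmap 1
  rw [← ofReal_integral_eq_lintegral_ofReal hint (ae_of_all _ fun y => (Real.exp_pos _).le)]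
  simp only [mgf, one_mul] at hm
  rw [hm]
  congr 2
  simp

/-- Rotations preserve the product of two standard Gaussians, so every angle contributes the same
integral. With the first variable frozen, the derivative is a linear functional of a Gaussian, of
norm at most M. -/
theorem lintegral_exp_sub_le_of_contDiff {g : E → ℝ} (hg : ContDiff ℝ 1 g) {M : ℝ≥0}
    (hM : LipschitzWith M g) (θ : ℝ) :
    ∫⁻ p, ENNReal.ofReal (Real.exp (θ * (g p.2 - g p.1))) ∂((stdGaussian E).prod (stdGaussian E))
      ≤ ENNReal.ofReal (Real.exp (θ ^ 2 * Real.pi ^ 2 * (M : ℝ) ^ 2 / 8)) := by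
  set V := stdGaussian E
  set c := θ * (Real.pi / 2)
  set F : E × E → ℝ≥0∞ := fun p => ENNReal.ofReal (Real.exp (c * fderiv ℝ g p.1 p.2)) with hF
  have hFc : Continuous F := by
    refine ENNReal.continuous_ofReal.comp (Real.continuous_exp.comp (continuous_const.mul ?_))
    exact ((hg.continuous_fderiv (by norm_num)).comp continuous_fst).clm_apply continuous_snd
  have hrot : Continuous (fun z : (E × E) × ℝ =>
      (ContinuousLinearMap.rotation z.2 z.1 : E × E)) := by
    simp only [ContinuousLinearMap.rotation_apply]
    fun_prop
  have hFV : ∫⁻ p, F p ∂(V.prod V) ≤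
      ENNReal.ofReal (Real.exp (θ ^ 2 * Real.pi ^ 2 * (M : ℝ) ^ 2 / 8)) := by
    rw [lintegral_prod _ hFc.measurable.aemeasurable]
    calc ∫⁻ x, ∫⁻ y, F (x, y) ∂V ∂V
        ≤ ∫⁻ _, ENNReal.ofReal (Real.exp (θ ^ 2 * Real.pi ^ 2 * (M : ℝ) ^ 2 / 8)) ∂V := by
          refine lintegral_mono fun x => ?_
          have h := lintegral_exp_dual_stdGaussian (c • fderiv ℝ g x)
          simp only [smul_apply, smul_eq_mul] at h
          simp only [hF]
          refine h.le.trans (ENNReal.ofReal_le_ofReal (Real.exp_le_exp.2 ?_))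
          have h1 : ‖fderiv ℝ g x‖ ≤ M := norm_fderiv_le_of_lipschitz ℝ hM
          rw [norm_smul, mul_pow, Real.norm_eq_abs, sq_abs]
          have h2 : ‖fderiv ℝ g x‖ ^ 2 ≤ (M : ℝ) ^ 2 := by gcongr
          have h3 : c ^ 2 = θ ^ 2 * Real.pi ^ 2 / 4 := by simp only [c]; ring
          rw [h3]
          have : 0 ≤ θ ^ 2 * Real.pi ^ 2 / 4 := by positivity
          nlinarith
      _ = _ := by simp
  calc ∫⁻ p, ENNReal.ofReal (Real.exp (θ * (g p.2 - g p.1))) ∂(V.prod V)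
      ≤ ∫⁻ p, ENNReal.ofReal (2 / Real.pi) * (∫⁻ φ in Ioc (0 : ℝ) (Real.pi / 2),
          F (ContinuousLinearMap.rotation φ p)) ∂(V.prod V) :=
        lintegral_mono fun p => exp_sub_le_average hg θ p
    _ = ENNReal.ofReal (2 / Real.pi) * ∫⁻ φ in Ioc (0 : ℝ) (Real.pi / 2), ∫⁻ p,
          F (ContinuousLinearMap.rotation φ p) ∂(V.prod V) := by
        rw [lintegral_const_mul' _ _ ENNReal.ofReal_ne_top, lintegral_lintegral_swap]
        exact (hFc.comp hrot).measurable.aemeasurable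
    _ = ENNReal.ofReal (2 / Real.pi) * ∫⁻ φ in Ioc (0 : ℝ) (Real.pi / 2), ∫⁻ p, F p ∂(V.prod V) := by
        congr 1
        refine lintegral_congr fun φ => ?_
        have h := IsGaussian.map_rotation_eq_self (μ := V) (by simp [V]) φ
        conv_rhs => rw [← h]
        rw [lintegral_map hFc.measurable (by fun_prop)]
    _ = ∫⁻ p, F p ∂(V.prod V) := by
        rw [setLIntegral_const, Real.volume_Ioc, sub_zero, mul_comm, mul_assoc,
          ← ENNReal.ofReal_mul (by positivity)]
        have : Real.pi / 2 * (2 / Real.pi) = 1 := by field_simp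
        rw [this]; simp
    _ ≤ _ := hFV

/-- Mollification: averaging translates keeps the Lipschitz constant and moves values by at most M
times the support radius. -/
theorem LipschitzWith.exists_contDiff_near {g : E → ℝ} {M : ℝ≥0} (hM : LipschitzWith M g) {ε : ℝ}
    (hε : 0 < ε) :
    ∃ k : E → ℝ, ContDiff ℝ 1 k ∧ LipschitzWith M k ∧ ∀ x, dist (k x) (g x) ≤ M * ε := by
  let φ : ContDiffBump (0 : E) := ⟨ε / 2, ε, by positivity, by linarith⟩
  have hconv : ∀ x, ConvolutionExistsAt (φ.normed volume) g x (ContinuousLinearMap.lsmul ℝ ℝ)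
      volume := by
    intro x
    exact φ.hasCompactSupport_normed.convolutionExists_left _ φ.continuous_normed
      hM.continuous.locallyIntegrable x
  refine ⟨φ.normed volume ⋆[ContinuousLinearMap.lsmul ℝ ℝ, volume] g, ?_, ?_, ?_⟩
  · exact (φ.hasCompactSupport_normed.contDiff_convolution_left _ φ.contDiff_normed
      hM.continuous.locallyIntegrable)
  · refine LipschitzWith.of_dist_le_mul fun x y => ?_
    rw [Real.dist_eq]
    simp only [convolution_def]
    rw [← integral_sub (hconv x) (hconv y)]
    have hbound : ∀ t, ‖(ContinuousLinearMap.lsmul ℝ ℝ (φ.normed volume t)) (g (x - t)) -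
        (ContinuousLinearMap.lsmul ℝ ℝ (φ.normed volume t)) (g (y - t))‖
        ≤ φ.normed volume t * (M * dist x y) := by
      intro t
      rw [← map_sub]
      simp only [ContinuousLinearMap.lsmul_apply, smul_eq_mul, norm_mul]
      rw [Real.norm_of_nonneg (φ.nonneg_normed t)]
      gcongr
      · exact φ.nonneg_normed t
      · have := hM.dist_le_mul (x - t) (y - t)
        rwa [dist_sub_right, Real.dist_eq] at this
    refine (norm_integral_le_of_norm_le (φ.integrable_normed.mul_const _)
      (ae_of_all _ hbound)).trans ?_
    rw [integral_mul_const, φ.integral_normed, one_mul]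
  · intro x
    refine φ.dist_normed_convolution_le hM.continuous.aestronglyMeasurable fun y hy => ?_
    refine (hM.dist_le_mul y x).trans ?_
    gcongr
    exact (Metric.mem_ball.1 hy).le

theorem lintegral_exp_sub_le_of_lipschitz {g : E → ℝ} {M : ℝ≥0} (hM : LipschitzWith M g)
    (θ : ℝ) :
    ∫⁻ p, ENNReal.ofReal (Real.exp (θ * (g p.2 - g p.1))) ∂((stdGaussian E).prod (stdGaussian E))
      ≤ ENNReal.ofReal (Real.exp (θ ^ 2 * Real.pi ^ 2 * (M : ℝ) ^ 2 / 8)) := by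
  have key : ∀ ε : ℝ, 0 < ε → ∫⁻ p, ENNReal.ofReal (Real.exp (θ * (g p.2 - g p.1)))
      ∂((stdGaussian E).prod (stdGaussian E))
      ≤ ENNReal.ofReal (Real.exp (2 * |θ| * (M * ε) + θ ^ 2 * Real.pi ^ 2 * (M : ℝ) ^ 2 / 8)) := by
    intro ε hε
    obtain ⟨k, hk1, hk2, hk3⟩ := hM.exists_contDiff_near hε
    have h := lintegral_exp_sub_le_of_contDiff hk1 hk2 θ
    rw [Real.exp_add, ENNReal.ofReal_mul (Real.exp_pos _).le]
    refine le_trans ?_ (mul_le_mul_right h _)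
    rw [← lintegral_const_mul' _ _ ENNReal.ofReal_ne_top]
    refine lintegral_mono fun p => ?_
    rw [← ENNReal.ofReal_mul (Real.exp_pos _).le, ← Real.exp_add]
    refine ENNReal.ofReal_le_ofReal (Real.exp_le_exp.2 ?_)
    have h1 := hk3 p.1
    have h2 := hk3 p.2
    rw [Real.dist_eq] at h1 h2
    have h3 : |(g p.2 - g p.1) - (k p.2 - k p.1)| ≤ 2 * (M * ε) := by
      rw [abs_le] at *
      constructor <;> linarith [h1.1, h1.2, h2.1, h2.2]
    have h4 : θ * ((g p.2 - g p.1) - (k p.2 - k p.1)) ≤ |θ| * (2 * (M * ε)) :=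
      (le_abs_self _).trans (by rw [abs_mul]; gcongr)
    linarith
  have hlim : Tendsto (fun ε : ℝ => ENNReal.ofReal (Real.exp (2 * |θ| * (M * ε) +
      θ ^ 2 * Real.pi ^ 2 * (M : ℝ) ^ 2 / 8))) (𝓝[>] 0)
      (𝓝 (ENNReal.ofReal (Real.exp (2 * |θ| * (M * 0) +
        θ ^ 2 * Real.pi ^ 2 * (M : ℝ) ^ 2 / 8)))) := by
    refine Tendsto.mono_left (Continuous.tendsto ?_ 0) nhdsWithin_le_nhds
    exact ENNReal.continuous_ofReal.comp (by fun_prop)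
  have := ge_of_tendsto hlim (by filter_upwards [self_mem_nhdsWithin] with ε hε using key ε hε)
  simpa using this

/-- Markov's inequality for two independent copies. No mean enters, so the bound can be used
directly around a median. -/
theorem stdGaussian_tail_mul_le {g : E → ℝ} {M : ℝ≥0} (hM : LipschitzWith M g) (hM0 : 0 < M)
    (m : ℝ) {t : ℝ} (ht : 0 ≤ t) :
    stdGaussian E {x | g x ≤ m} * stdGaussian E {x | m + Real.pi / 2 * M * t ≤ g x}
      ≤ ENNReal.ofReal (Real.exp (-t ^ 2 / 2)) := by
  have hM0' : (0 : ℝ) < M := hM0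
  have hpi := Real.pi_pos
  rw [← Measure.prod_prod]
  -- The minimiser of θ²π²M²/8 - θs for s = πMt/2, with minimum -t²/2.
  set θ : ℝ := 2 * t / (Real.pi * M) with hθ
  have hθ0 : 0 ≤ θ := by positivity
  set s : ℝ := Real.pi / 2 * M * t with hs
  have h1 : (ENNReal.ofReal (Real.exp (θ * s))) *
      ((stdGaussian E).prod (stdGaussian E)) ({x | g x ≤ m} ×ˢ {x | m + s ≤ g x}) ≤
      ENNReal.ofReal (Real.exp (θ ^ 2 * Real.pi ^ 2 * (M : ℝ) ^ 2 / 8)) := by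
    refine le_trans ?_ (lintegral_exp_sub_le_of_lipschitz hM θ)
    refine le_trans ?_ (mul_meas_ge_le_lintegral ?_ (ENNReal.ofReal (Real.exp (θ * s))))
    · gcongr
      rintro ⟨x, y⟩ ⟨hx, hy⟩
      simp only [mem_ofPred_eq] at hx hy ⊢
      refine ENNReal.ofReal_le_ofReal (Real.exp_le_exp.2 ?_)
      gcongr
      linarith
    · have := hM.continuous
      exact (ENNReal.continuous_ofReal.comp (by fun_prop)).measurable
  have h2 : θ * s = t ^ 2 := by rw [hθ, hs]; field_simp
  have h3 : θ ^ 2 * Real.pi ^ 2 * (M : ℝ) ^ 2 / 8 = t ^ 2 + -t ^ 2 / 2 := by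
    rw [hθ]; field_simp; ring
  rw [h2, h3, Real.exp_add, ENNReal.ofReal_mul (Real.exp_pos _).le] at h1
  exact (ENNReal.mul_le_mul_iff_right (by simp [Real.exp_pos]) ENNReal.ofReal_ne_top).1 h1

end GaussianConcentration

/-! ### From pointwise slopes to Lipschitz bounds on convex sets -/

section LipschitzFromSlopes

open scoped NNReal

/-- The pointwise Lipschitz constant of `F` at `z`, an upper limit of difference quotients based
at `z`, is at most `M`. -/
def SlopeLE {E : Type*} [NormedAddCommGroup E] (F : E → ℝ) (z : E) (M : ℝ) : Prop :=
  ∀ r, M < r → ∀ᶠ w in 𝓝 z, |F w - F z| ≤ r * ‖w - z‖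

theorem SlopeLE.continuousAt {E : Type*} [NormedAddCommGroup E] {F : E → ℝ} {z : E} {M : ℝ}
    (h : SlopeLE F z M) : ContinuousAt F z := by
  rw [ContinuousAt, tendsto_iff_norm_sub_tendsto_zero]
  refine squeeze_zero' (Eventually.of_forall fun _ => norm_nonneg _) (h (M + 1) (by linarith)) ?_
  have : Tendsto (fun w : E => (M + 1) * ‖w - z‖) (𝓝 z) (𝓝 ((M + 1) * ‖z - z‖)) :=
    Continuous.tendsto (by fun_prop) z
  simpa using this

/-- A mean value inequality without differentiability: along the segment, which stays in K, the
right slopes are at most M‖y - x‖, so F stays below the corresponding affine function. -/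
theorem sub_le_of_slopeLE {E : Type*} [NormedAddCommGroup E] [NormedSpace ℝ E] {F : E → ℝ}
    {K : Set E} (hK : Convex ℝ K) {M : ℝ} (hF : ∀ z ∈ K, SlopeLE F z M) {x y : E} (hx : x ∈ K)
    (hy : y ∈ K) : F y - F x ≤ M * ‖y - x‖ := by
  rcases eq_or_ne x y with rfl | hxy
  · simp
  have hv : 0 < ‖y - x‖ := norm_pos_iff.2 (sub_ne_zero.2 hxy.symm)
  have hmem : ∀ τ ∈ Icc (0 : ℝ) 1, x + τ • (y - x) ∈ K := fun τ hτ =>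
    hK.add_smul_sub_mem hx hy hτ
  have hline : Continuous (fun τ : ℝ => x + τ • (y - x)) := by fun_prop
  have hcont : ContinuousOn (fun τ : ℝ => F (x + τ • (y - x))) (Icc 0 1) := fun τ hτ =>
    ((hF _ (hmem τ hτ)).continuousAt.comp
      (f := fun τ : ℝ => x + τ • (y - x)) hline.continuousAt).continuousWithinAt
  have h := image_le_of_liminf_slope_right_le_deriv_boundary hcont
    (B := fun τ => F x + τ * (M * ‖y - x‖)) (B' := fun _ => M * ‖y - x‖) (by simp) (by fun_prop)
    (fun τ _ => by
      simpa using (((hasDerivAt_id τ).mul_const (M * ‖y - x‖)).const_add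
        (F x)).hasDerivWithinAt) ?_ (right_mem_Icc.2 zero_le_one)
  · simp only [one_smul, one_mul, add_sub_cancel] at h
    linarith
  · intro τ hτ r hr
    have hr' : M < r / ‖y - x‖ := by rwa [lt_div_iff₀ hv]
    obtain ⟨r', h1, h2⟩ := exists_between hr'
    have hev : ∀ᶠ σ in 𝓝[>] τ, |F (x + σ • (y - x)) - F (x + τ • (y - x))|
        ≤ r' * ‖(x + σ • (y - x)) - (x + τ • (y - x))‖ :=
      (hline.tendsto τ).mono_left nhdsWithin_le_nhds
        |>.eventually (hF _ (hmem τ (Ico_subset_Icc_self hτ)) r' h1)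
    refine Eventually.frequently ?_
    filter_upwards [hev, self_mem_nhdsWithin] with σ hσ hlt
    have hlt' : 0 < σ - τ := sub_pos.2 hlt
    rw [slope_def_field, div_lt_iff₀ hlt']
    have he : (x + σ • (y - x)) - (x + τ • (y - x)) = (σ - τ) • (y - x) := by
      rw [sub_smul]; abel
    rw [he, norm_smul, Real.norm_of_nonneg hlt'.le] at hσ
    have h3 : r' * ‖y - x‖ < r := by rwa [lt_div_iff₀ hv] at h2
    calc _ ≤ r' * ((σ - τ) * ‖y - x‖) := (le_abs_self _).trans hσ
      _ = (r' * ‖y - x‖) * (σ - τ) := by ring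
      _ < r * (σ - τ) := by gcongr

theorem lipschitzOnWith_of_slopeLE {E : Type*} [NormedAddCommGroup E] [NormedSpace ℝ E]
    {F : E → ℝ} {K : Set E} (hK : Convex ℝ K) {M : ℝ≥0} (hF : ∀ z ∈ K, SlopeLE F z M) :
    LipschitzOnWith M F K := by
  refine LipschitzOnWith.of_dist_le_mul fun x hx y hy => ?_
  rw [Real.dist_eq, dist_eq_norm, abs_le]
  have h1 := sub_le_of_slopeLE hK hF hx hy
  have h2 := sub_le_of_slopeLE hK hF hy hx
  rw [norm_sub_rev] at h1
  constructor <;> linarith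

/-- First-order expansion of f at T(z), then Cauchy–Schwarz. The T_i need only pointwise slope
bounds and f only plain differentiability. -/
theorem slopeLE_comp_coord {n : ℕ} {f : (Fin n → ℝ) → ℝ} (hf : Differentiable ℝ f)
    {T : Fin n → ℝ → ℝ} {z : EuclideanSpace ℝ (Fin n)} {ℓ : Fin n → ℝ}
    (hT : ∀ i, SlopeLE (T i) (z i) (ℓ i)) :
    SlopeLE (fun w : EuclideanSpace ℝ (Fin n) => f (fun i => T i (w i))) z
      (√(∑ i, (partialD f i (fun i => T i (z i)) * ℓ i) ^ 2)) := by
  intro r hr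
  set x : Fin n → ℝ := fun i => T i (z i) with hx
  set d : Fin n → ℝ := fun i => partialD f i x with hd
  have hlim : Tendsto (fun δ : ℝ => √(∑ i, ((|d i| + δ) * (ℓ i + δ)) ^ 2)) (𝓝[>] 0)
      (𝓝 (√(∑ i, ((|d i| + 0) * (ℓ i + 0)) ^ 2))) :=
    (Continuous.tendsto (by fun_prop) 0).mono_left nhdsWithin_le_nhds
  have heq : √(∑ i, ((|d i| + 0) * (ℓ i + 0)) ^ 2) = √(∑ i, (d i * ℓ i) ^ 2) := by
    congr 1
    refine Finset.sum_congr rfl fun i _ => ?_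
    rw [add_zero, add_zero, mul_pow, mul_pow, sq_abs]
  rw [heq] at hlim
  obtain ⟨δ, hδr, hδ0⟩ := ((hlim.eventually (gt_mem_nhds hr)).and self_mem_nhdsWithin).exists
  have hδ : 0 < δ := hδ0
  have hTc : Tendsto (fun w : EuclideanSpace ℝ (Fin n) => (fun i => T i (w i))) (𝓝 z) (𝓝 x) := by
    refine tendsto_pi_nhds.2 fun i => ?_
    exact ((hT i).continuousAt.tendsto).comp
      ((by fun_prop : Continuous fun w : EuclideanSpace ℝ (Fin n) => w i).tendsto z)
  have hfd := (hf x).hasFDerivAt.isLittleO.def hδ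
  have hTe : ∀ᶠ w in 𝓝 z, ∀ i, |T i (w i) - T i (z i)| ≤ (ℓ i + δ) * ‖w i - z i‖ := by
    refine eventually_all.2 fun i => ?_
    exact ((by fun_prop : Continuous fun w : EuclideanSpace ℝ (Fin n) => w i).tendsto z).eventually
      (hT i (ℓ i + δ) (by linarith))
  filter_upwards [hTc.eventually hfd, hTe] with w hw1 hw2
  set y : Fin n → ℝ := fun i => T i (w i) with hy
  have hlin : fderiv ℝ f x (y - x) = ∑ i, d i * (y i - x i) := by
    conv_lhs => rw [pi_eq_sum_univ' (y - x)]
    rw [map_sum]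
    refine Finset.sum_congr rfl fun i _ => ?_
    simp only [map_smul, hd, partialD, Pi.sub_apply, smul_eq_mul]
    rw [mul_comm]
  have hnorm : ‖y - x‖ ≤ ∑ i, |y i - x i| := by
    refine (pi_norm_le_iff_of_nonneg (Finset.sum_nonneg fun _ _ => abs_nonneg _)).2 fun i => ?_
    exact Finset.single_le_sum (f := fun i => |y i - x i|) (fun _ _ => abs_nonneg _)
      (Finset.mem_univ i)
  rw [hlin, Real.norm_eq_abs] at hw1
  have h1 : |f y - f x| ≤ ∑ i, ((|d i| + δ) * (ℓ i + δ)) * |w i - z i| := by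
    calc |f y - f x| = |(f y - f x - ∑ i, d i * (y i - x i)) + ∑ i, d i * (y i - x i)| := by
          congr 1; ring
      _ ≤ δ * ∑ i, |y i - x i| + ∑ i, |d i| * |y i - x i| := by
          refine (abs_add_le _ _).trans (add_le_add (hw1.trans (by gcongr)) ?_)
          refine (Finset.abs_sum_le_sum_abs _ _).trans_eq ?_
          simp_rw [abs_mul]
      _ = ∑ i, (|d i| + δ) * |y i - x i| := by
          rw [Finset.mul_sum, ← Finset.sum_add_distrib]
          exact Finset.sum_congr rfl fun i _ => by ring
      _ ≤ _ := by
          refine Finset.sum_le_sum fun i _ => ?_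
          rw [mul_assoc]
          have := hw2 i
          rw [Real.norm_eq_abs] at this
          gcongr
  refine h1.trans ((Real.sum_mul_le_sqrt_mul_sqrt _ _ _).trans ?_)
  have h2 : √(∑ i, |w i - z i| ^ 2) = ‖w - z‖ := by
    rw [EuclideanSpace.norm_eq]
    simp
  rw [h2]
  gcongr

end LipschitzFromSlopes

/-! ### Concentration for functions Lipschitz only on a large set -/

section Concentration

open scoped NNReal

/-- A Lipschitz extension g agrees with G on K. Since t ≥ 2, the complement of K has mass at most
e^{-2} ≤ 1/4, so g lies on either side of m with probability at least 1/4; each tail of g then costs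
4e^{-t²/2}, and leaving K costs one more. -/
theorem stdGaussian_deviation_le {n : ℕ} {G : EuclideanSpace ℝ (Fin n) → ℝ}
    {K : Set (EuclideanSpace ℝ (Fin n))} {M : ℝ≥0} (hM0 : 0 < M) (hG : LipschitzOnWith M G K)
    {t : ℝ} (ht : 2 ≤ t)
    (hK : stdGaussian (EuclideanSpace ℝ (Fin n)) Kᶜ ≤ ENNReal.ofReal (Real.exp (-t ^ 2 / 2)))
    {m : ℝ} (hm : IsMedian (stdGaussian (EuclideanSpace ℝ (Fin n))) G m) :
    stdGaussian (EuclideanSpace ℝ (Fin n)) {x | Real.pi / 2 * M * t < |G x - m|}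
      ≤ ENNReal.ofReal (10 * Real.exp (-t ^ 2 / 2)) := by
  set V := stdGaussian (EuclideanSpace ℝ (Fin n))
  set α := ENNReal.ofReal (Real.exp (-t ^ 2 / 2)) with hα
  obtain ⟨g, hg, hgG⟩ := hG.extend_real
  have hα4 : α ≤ 1 / 4 := by
    rw [hα, show (1 / 4 : ℝ≥0∞) = ENNReal.ofReal (1 / 4) by
      rw [ENNReal.ofReal_div_of_pos (by norm_num)]; simp]
    refine ENNReal.ofReal_le_ofReal ?_
    have h1 : Real.exp (-t ^ 2 / 2) ≤ Real.exp (-2) := Real.exp_le_exp.2 (by nlinarith)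
    have h2 : (4 : ℝ) ≤ Real.exp 2 := by
      have := Real.exp_one_gt_d9
      rw [show (2 : ℝ) = 1 + 1 by norm_num, Real.exp_add]
      nlinarith
    rw [Real.exp_neg] at h1
    refine h1.trans ?_
    rw [inv_le_comm₀ (Real.exp_pos _) (by norm_num)]
    linarith
  have hq : (1 / 2 : ℝ≥0∞) = 1 / 4 + 1 / 4 := by
    rw [← ENNReal.toReal_eq_toReal_iff' (by simp) (by simp), ENNReal.toReal_add (by simp) (by simp)]
    norm_num
  have hquart : ∀ A B : Set (EuclideanSpace ℝ (Fin n)), 1 / 2 ≤ V A → A ⊆ B ∪ Kᶜ →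
      1 / 4 ≤ V B := by
    intro A B hA hAB
    have h1 : (1 / 4 : ℝ≥0∞) + 1 / 4 ≤ V B + 1 / 4 := by
      rw [← hq]
      exact hA.trans ((measure_mono hAB).trans ((measure_union_le _ _).trans
        (add_le_add_right (hK.trans hα4) _)))
    exact (ENNReal.add_le_add_iff_right (by simp)).1 h1
  have htail : ∀ (k : EuclideanSpace ℝ (Fin n) → ℝ) (c : ℝ), LipschitzWith M k →
      1 / 4 ≤ V {x | k x ≤ c} → V {x | c + Real.pi / 2 * M * t ≤ k x} ≤ 4 * α := by
    intro k c hk hc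
    have h1 := stdGaussian_tail_mul_le hk hM0 c (by linarith : 0 ≤ t)
    have h2 : 1 / 4 * V {x | c + Real.pi / 2 * M * t ≤ k x} ≤ α :=
      (mul_le_mul_left hc _).trans h1
    calc _ = 4 * (1 / 4 * V {x | c + Real.pi / 2 * M * t ≤ k x}) := by
          rw [← mul_assoc, one_div, ENNReal.mul_inv_cancel (by norm_num) (by norm_num), one_mul]
      _ ≤ _ := by gcongr
  have hup := htail g m hg (hquart _ _ hm.1 fun x hx => by
    by_cases hxK : x ∈ K
    · left
      rw [mem_ofPred_eq, ← hgG hxK]; exact hx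
    · exact Or.inr hxK)
  have hdown := htail (fun x => -g x) (-m) hg.neg (hquart _ _ hm.2 fun x hx => by
    by_cases hxK : x ∈ K
    · left
      rw [mem_ofPred_eq, ← hgG hxK]; exact neg_le_neg hx
    · exact Or.inr hxK)
  have hsub : {x | Real.pi / 2 * M * t < |G x - m|} ⊆ Kᶜ ∪ ({x | m + Real.pi / 2 * M * t ≤ g x} ∪
      {x | -m + Real.pi / 2 * M * t ≤ -g x}) := by
    intro x hx
    by_cases hxK : x ∈ K
    · right
      rw [mem_ofPred_eq, hgG hxK] at hx
      rcases lt_abs.1 hx with h | h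
      · left; rw [mem_ofPred_eq]; linarith
      · right; rw [mem_ofPred_eq]; linarith
    · exact Or.inl hxK
  calc _ ≤ α + (4 * α + 4 * α) := (measure_mono hsub).trans ((measure_union_le _ _).trans
        (add_le_add hK ((measure_union_le _ _).trans (add_le_add hup hdown))))
    _ = 9 * α := by ring
    _ ≤ 10 * α := by gcongr; norm_num
    _ = _ := by rw [ENNReal.ofReal_mul (by norm_num)]; simp [hα]

end Concentration

/-! ### Monotone transport of the Gaussian and the growth of its slope -/

section GaussianTransport

theorem gaussianPDFReal_zero_one (x : ℝ) :
    gaussianPDFReal 0 1 x = (√(2 * Real.pi))⁻¹ * Real.exp (-x ^ 2 / 2) := by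
  simp [gaussianPDFReal]

theorem continuous_gaussianPDFReal_zero_one : Continuous (gaussianPDFReal 0 1) := by
  simp only [funext gaussianPDFReal_zero_one]
  fun_prop

theorem cdf_gaussianReal_sub (a b : ℝ) :
    cdf (gaussianReal 0 1) b - cdf (gaussianReal 0 1) a = ∫ x in a..b, gaussianPDFReal 0 1 x := by
  have h : ∀ x, cdf (gaussianReal 0 1) x = ∫ y in Iic x, gaussianPDFReal 0 1 y := by
    intro x
    rw [cdf_eq_real, measureReal_def, gaussianReal_apply_eq_integral 0 one_ne_zero,
      ENNReal.toReal_ofReal]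
    exact setIntegral_nonneg measurableSet_Iic fun y _ => gaussianPDFReal_nonneg 0 1 y
  rw [h, h]
  exact intervalIntegral.integral_Iic_sub_Iic (integrable_gaussianPDFReal 0 1).integrableOn
    (integrable_gaussianPDFReal 0 1).integrableOn

theorem hasDerivAt_cdf_gaussianReal (z : ℝ) :
    HasDerivAt (cdf (gaussianReal 0 1)) (gaussianPDFReal 0 1 z) z := by
  have h : (fun x => cdf (gaussianReal 0 1) x) = fun x => cdf (gaussianReal 0 1) z +
      ∫ y in z..x, gaussianPDFReal 0 1 y := by
    ext x
    rw [← cdf_gaussianReal_sub]; ring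
  change HasDerivAt (fun x => cdf (gaussianReal 0 1) x) _ _
  rw [h]
  exact ((continuous_gaussianPDFReal_zero_one.integral_hasStrictDerivAt z z).hasDerivAt).const_add _

/-- A constant in the lower bound for Gaussian tails. -/
noncomputable def millsConst : ℝ := (√(2 * Real.pi))⁻¹ * Real.exp (-(3 / 2))

theorem millsConst_pos : 0 < millsConst := by unfold millsConst; positivity

/-- On this window w² ≤ z² + 2 + 1, which is the origin of the factor e^{-3/2} in `millsConst`. -/
theorem millsConst_le_gaussianPDFReal {z w : ℝ} (h : |w - z| ≤ 1 / (1 + |z|)) :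
    millsConst * Real.exp (-z ^ 2 / 2) ≤ gaussianPDFReal 0 1 w := by
  rw [gaussianPDFReal_zero_one, millsConst, mul_assoc, ← Real.exp_add]
  gcongr
  have h0 : 0 ≤ |z| := abs_nonneg z
  have h1 : |w| ≤ |z| + 1 / (1 + |z|) := by
    calc |w| = |(w - z) + z| := by congr 1; ring
      _ ≤ |w - z| + |z| := abs_add_le _ _
      _ ≤ _ := by linarith
  have h2 : w ^ 2 ≤ (|z| + 1 / (1 + |z|)) ^ 2 := by
    rw [← sq_abs w]; gcongr
  have h3 : |z| * (1 / (1 + |z|)) ≤ 1 := by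
    rw [mul_one_div, div_le_one (by positivity)]; linarith
  have h4 : (1 / (1 + |z|)) ≤ 1 := by
    rw [div_le_one (by positivity)]; linarith
  have h5 : 0 ≤ 1 / (1 + |z|) := by positivity
  have h6 : (1 / (1 + |z|)) ^ 2 ≤ 1 := by nlinarith
  have h7 := sq_abs z
  nlinarith

/-- Each tail contains a window of length 1/(1+|z|) ending at z, on which the density is comparable
to its value at z. -/
theorem gaussian_tails_ge (z : ℝ) :
    millsConst * Real.exp (-z ^ 2 / 2) / (1 + |z|) ≤
      min (cdf (gaussianReal 0 1) z) (1 - cdf (gaussianReal 0 1) z) := by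
  set δ : ℝ := 1 / (1 + |z|) with hδ
  have hδ0 : 0 < δ := by positivity
  have key : ∀ a b : ℝ, b - a = δ → (∀ w ∈ Icc a b, |w - z| ≤ δ) →
      millsConst * Real.exp (-z ^ 2 / 2) / (1 + |z|) ≤
        cdf (gaussianReal 0 1) b - cdf (gaussianReal 0 1) a := by
    intro a b hab hw
    rw [cdf_gaussianReal_sub]
    have h1 := intervalIntegral.integral_mono_on (μ := volume) (a := a) (b := b) (by linarith)
      (f := fun _ => millsConst * Real.exp (-z ^ 2 / 2)) (g := gaussianPDFReal 0 1)
      (by simp) (continuous_gaussianPDFReal_zero_one.intervalIntegrable _ _)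
      (fun w hwab => millsConst_le_gaussianPDFReal (hw w hwab))
    rw [intervalIntegral.integral_const, hab, smul_eq_mul, hδ, one_div_mul_eq_div] at h1
    exact h1
  refine le_min ?_ ?_
  · refine (key (z - δ) z (by ring) fun w hw => ?_).trans ?_
    · rw [abs_le]; constructor <;> linarith [hw.1, hw.2]
    · linarith [cdf_nonneg (gaussianReal 0 1) (z - δ)]
  · refine (key z (z + δ) (by ring) fun w hw => ?_).trans ?_
    · rw [abs_le]; constructor <;> linarith [hw.1, hw.2]
    · linarith [cdf_le_one (gaussianReal 0 1) (z + δ)]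

theorem cdf_gaussianReal_mem_Ioo (z : ℝ) : cdf (gaussianReal 0 1) z ∈ Ioo (0 : ℝ) 1 := by
  have h := gaussian_tails_ge z
  have h1 : 0 < millsConst * Real.exp (-z ^ 2 / 2) / (1 + |z|) := by
    have := millsConst_pos
    positivity
  have h2 := h1.trans_le h
  rw [lt_min_iff] at h2
  exact ⟨h2.1, by linarith [h2.2]⟩

/-- The monotone map transporting the standard Gaussian measure to `μ`. -/
noncomputable def gaussTransport (μ : Measure ℝ) (z : ℝ) : ℝ :=
  quantileFn μ ⟨cdf (gaussianReal 0 1) z, cdf_gaussianReal_mem_Ioo z⟩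

/-- Right continuity of the distribution function makes the infimum attained; this gives both
measurability and the image law of the transport. -/
theorem quantileFn_le_iff (μ : Measure ℝ) (u : Ioo (0 : ℝ) 1) (x : ℝ) :
    quantileFn μ u ≤ x ↔ (u : ℝ) ≤ cdf μ x := by
  have hne : {t : ℝ | (u : ℝ) ≤ cdf μ t}.Nonempty := by
    obtain ⟨t, ht⟩ := ((tendsto_cdf_atTop μ).eventually (lt_mem_nhds u.2.2)).exists
    exact ⟨t, ht.le⟩
  have hbdd : BddBelow {t : ℝ | (u : ℝ) ≤ cdf μ t} := by
    obtain ⟨t, ht⟩ := ((tendsto_cdf_atBot μ).eventually (gt_mem_nhds u.2.1)).exists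
    refine ⟨t, fun s hs => ?_⟩
    by_contra! h
    exact absurd (hs.trans (monotone_cdf μ h.le)) (not_le.2 ht)
  constructor
  · intro h
    have h1 : ∀ y, x < y → (u : ℝ) ≤ cdf μ y := by
      intro y hy
      obtain ⟨t, ht, hty⟩ := exists_lt_of_csInf_lt hne (lt_of_le_of_lt h hy)
      exact le_trans ht (monotone_cdf μ hty.le)
    have h2 : Tendsto (cdf μ) (𝓝[>] x) (𝓝 (cdf μ x)) :=
      ((cdf μ).right_continuous x).mono_left (nhdsWithin_mono _ Ioi_subset_Ici_self)
    exact ge_of_tendsto h2 (by filter_upwards [self_mem_nhdsWithin] with y hy using h1 y hy)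
  · intro h
    exact csInf_le hbdd h

theorem measurable_gaussTransport (μ : Measure ℝ) : Measurable (gaussTransport μ) := by
  refine measurable_of_Iic fun x => ?_
  have : gaussTransport μ ⁻¹' Iic x = {z | cdf (gaussianReal 0 1) z ≤ cdf μ x} := by
    ext z
    exact quantileFn_le_iff μ _ x
  rw [this]
  exact measurableSet_le (monotone_cdf _).measurable measurable_const

theorem strictMono_cdf_gaussianReal : StrictMono (cdf (gaussianReal 0 1)) := by
  refine strictMono_of_deriv_pos fun z => ?_
  rw [(hasDerivAt_cdf_gaussianReal z).deriv]
  exact gaussianPDFReal_pos 0 1 z one_ne_zero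

theorem gaussianReal_cdf_le {u : ℝ} (h0 : 0 ≤ u) (h1 : u ≤ 1) :
    gaussianReal 0 1 {z | cdf (gaussianReal 0 1) z ≤ u} = ENNReal.ofReal u := by
  rcases h0.eq_or_lt with rfl | h0
  · have : {z | cdf (gaussianReal 0 1) z ≤ 0} = ∅ := by
      ext z
      simpa using (cdf_gaussianReal_mem_Ioo z).1
    simp [this]
  rcases h1.eq_or_lt with rfl | h1
  · have : {z | cdf (gaussianReal 0 1) z ≤ 1} = univ := by
      ext z
      simpa using (cdf_gaussianReal_mem_Ioo z).2.le
    simp [this]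
  obtain ⟨a, ha⟩ := ((tendsto_cdf_atBot (gaussianReal 0 1)).eventually (gt_mem_nhds h0)).exists
  obtain ⟨b, hb⟩ := ((tendsto_cdf_atTop (gaussianReal 0 1)).eventually (lt_mem_nhds h1)).exists
  have hc : Continuous (cdf (gaussianReal 0 1)) :=
    continuous_iff_continuousAt.2 fun z => (hasDerivAt_cdf_gaussianReal z).continuousAt
  obtain ⟨z, rfl⟩ := mem_range_of_exists_le_of_exists_ge hc ⟨a, ha.le⟩ ⟨b, hb.le⟩
  have : {w | cdf (gaussianReal 0 1) w ≤ cdf (gaussianReal 0 1) z} = Iic z := by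
    ext w
    exact strictMono_cdf_gaussianReal.le_iff_le
  rw [this, ofReal_cdf]

theorem map_gaussTransport (μ : Measure ℝ) [IsProbabilityMeasure μ] :
    (gaussianReal 0 1).map (gaussTransport μ) = μ := by
  have := Measure.isProbabilityMeasure_map (μ := gaussianReal 0 1)
    (measurable_gaussTransport μ).aemeasurable
  refine Measure.ext_of_Iic _ _ fun x => ?_
  rw [Measure.map_apply (measurable_gaussTransport μ) measurableSet_Iic, ← ofReal_cdf,
    ← gaussianReal_cdf_le (cdf_nonneg μ x) (cdf_le_one μ x)]
  congr 1
  ext z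
  exact quantileFn_le_iff μ _ x

theorem eventually_dist_le_of_localLip {α β : Type*} [MetricSpace α] [MetricSpace β] {T : α → β}
    {x : α} {c r : ℝ} (h : localLip T x ≤ ENNReal.ofReal c) (hc : 0 ≤ c) (hr : c < r) :
    ∀ᶠ y in 𝓝 x, dist (T y) (T x) ≤ r * dist y x := by
  have h1 : localLip T x < ENNReal.ofReal r :=
    h.trans_lt ((ENNReal.ofReal_lt_ofReal_iff (hc.trans_lt hr)).2 hr)
  simp only [localLip, iInf_lt_iff] at h1
  obtain ⟨ε, hε, hlt⟩ := h1
  filter_upwards [Metric.ball_mem_nhds x hε] with y hy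
  rcases eq_or_ne y x with rfl | hyx
  · simp
  have h2 : edist (T y) (T x) / edist y x ≤ ENNReal.ofReal r := by
    refine le_trans ?_ hlt.le
    exact le_iSup₂_of_le y hy (le_iSup₂_of_le x (Metric.mem_ball_self hε) le_rfl)
  rw [ENNReal.div_le_iff (by simpa using hyx) (edist_ne_top _ _), edist_dist, edist_dist,
    ← ENNReal.ofReal_mul (hc.trans hr.le)] at h2
  exact (ENNReal.ofReal_le_ofReal_iff
    (mul_nonneg (hc.trans hr.le) dist_nonneg)).1 h2

/-- The chain rule for F⁻¹ ∘ Φ, with the local Lipschitz constant in place of a derivative of F⁻¹.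
-/
theorem slopeLE_gaussTransport {μ : Measure ℝ} {z c : ℝ}
    (h : localLip (quantileFn μ) ⟨cdf (gaussianReal 0 1) z, cdf_gaussianReal_mem_Ioo z⟩
      ≤ ENNReal.ofReal c) (hc : 0 ≤ c) :
    SlopeLE (gaussTransport μ) z (c * gaussianPDFReal 0 1 z) := by
  intro r hr
  have hφ := gaussianPDFReal_nonneg 0 1 z
  have hlim : Tendsto (fun δ : ℝ => (c + δ) * (gaussianPDFReal 0 1 z + δ)) (𝓝[>] 0)
      (𝓝 ((c + 0) * (gaussianPDFReal 0 1 z + 0))) :=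
    (Continuous.tendsto (by fun_prop) 0).mono_left nhdsWithin_le_nhds
  rw [add_zero, add_zero] at hlim
  obtain ⟨δ, hδr, hδ0⟩ := ((hlim.eventually (gt_mem_nhds hr)).and self_mem_nhdsWithin).exists
  have hδ : 0 < δ := hδ0
  have hd := (hasDerivAt_cdf_gaussianReal z)
  have hcont : Tendsto (fun w => (⟨cdf (gaussianReal 0 1) w, cdf_gaussianReal_mem_Ioo w⟩ :
      Ioo (0 : ℝ) 1)) (𝓝 z) (𝓝 ⟨cdf (gaussianReal 0 1) z, cdf_gaussianReal_mem_Ioo z⟩) :=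
    tendsto_subtype_rng.2 hd.continuousAt
  have h1 := hcont.eventually (eventually_dist_le_of_localLip h hc (by linarith : c < c + δ))
  have h2 := hd.hasFDerivAt.isLittleO.def hδ
  filter_upwards [h1, h2] with w hw1 hw2
  rw [Real.dist_eq, Subtype.dist_eq, Real.dist_eq] at hw1
  simp only [ContinuousLinearMap.toSpanSingleton_apply, smul_eq_mul, Real.norm_eq_abs] at hw2
  have h3 : |cdf (gaussianReal 0 1) w - cdf (gaussianReal 0 1) z| ≤
      (gaussianPDFReal 0 1 z + δ) * |w - z| := by
    calc _ = |(cdf (gaussianReal 0 1) w - cdf (gaussianReal 0 1) z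
            - (w - z) * gaussianPDFReal 0 1 z) + (w - z) * gaussianPDFReal 0 1 z| := by
          congr 1; ring
      _ ≤ δ * |w - z| + |w - z| * gaussianPDFReal 0 1 z := by
          refine (abs_add_le _ _).trans (add_le_add hw2 ?_)
          rw [abs_mul, abs_of_nonneg hφ]
      _ = _ := by ring
  calc |gaussTransport μ w - gaussTransport μ z|
      ≤ (c + δ) * |cdf (gaussianReal 0 1) w - cdf (gaussianReal 0 1) z| := hw1
    _ ≤ (c + δ) * ((gaussianPDFReal 0 1 z + δ) * |w - z|) := by gcongr
    _ = (c + δ) * (gaussianPDFReal 0 1 z + δ) * ‖w - z‖ := by rw [Real.norm_eq_abs]; ring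
    _ ≤ r * ‖w - z‖ := by gcongr

/-- An envelope for the local Lipschitz constants of `gaussTransport μ`. -/
noncomputable def slopeEnvelope (q z : ℝ) : ℝ :=
  (1 + |z|) ^ (1 + 1 / q) * Real.exp (z ^ 2 / (2 * q))

theorem slopeEnvelope_nonneg (q z : ℝ) : 0 ≤ slopeEnvelope q z := by
  unfold slopeEnvelope; positivity

/-- Raising the tail bound to the power -1-1/q produces e^{z²/2 + z²/(2q)}; the density cancels the
first half of the exponent. -/
theorem tails_rpow_mul_pdf_le {q : ℝ} (hq : 0 < q) (z : ℝ) :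
    (min (cdf (gaussianReal 0 1) z) (1 - cdf (gaussianReal 0 1) z)) ^ (-1 - 1 / q) *
      gaussianPDFReal 0 1 z ≤ millsConst ^ (-1 - 1 / q) * slopeEnvelope q z := by
  have hm := millsConst_pos
  have hexp : -1 - 1 / q ≤ 0 := by
    have : 0 < 1 / q := by positivity
    linarith
  have h1 := Real.rpow_le_rpow_of_nonpos (by positivity) (gaussian_tails_ge z) hexp
  have h2 : (millsConst * Real.exp (-z ^ 2 / 2) / (1 + |z|)) ^ (-1 - 1 / q) =
      millsConst ^ (-1 - 1 / q) * Real.exp (z ^ 2 / (2 * q) + z ^ 2 / 2) *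
        (1 + |z|) ^ (1 + 1 / q) := by
    rw [Real.div_rpow (by positivity) (by positivity), Real.mul_rpow hm.le (Real.exp_pos _).le,
      ← Real.exp_mul, show -1 - 1 / q = -(1 + 1 / q) by ring,
      Real.rpow_neg (by positivity : 0 ≤ 1 + |z|), div_inv_eq_mul]
    congr 3
    field_simp
    ring
  have h3 : gaussianPDFReal 0 1 z ≤ Real.exp (-z ^ 2 / 2) := by
    rw [gaussianPDFReal_zero_one]
    have : (√(2 * Real.pi))⁻¹ ≤ 1 := by
      refine inv_le_one_of_one_le₀ (Real.one_le_sqrt.2 ?_)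
      linarith [Real.pi_gt_three]
    exact mul_le_of_le_one_left (Real.exp_pos _).le this
  calc _ ≤ (millsConst ^ (-1 - 1 / q) * Real.exp (z ^ 2 / (2 * q) + z ^ 2 / 2) *
        (1 + |z|) ^ (1 + 1 / q)) * Real.exp (-z ^ 2 / 2) := by
        rw [← h2]
        have := gaussianPDFReal_nonneg 0 1 z
        gcongr
    _ = _ := by
        rw [slopeEnvelope, Real.exp_add, neg_div, Real.exp_neg]
        field_simp

theorem SlopeLE.mono {E : Type*} [NormedAddCommGroup E] {F : E → ℝ} {z : E} {M M' : ℝ}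
    (h : SlopeLE F z M) (hM : M ≤ M') : SlopeLE F z M' := fun r hr => h r (hM.trans_lt hr)

theorem slopeLE_gaussTransport_envelope {μ : Measure ℝ} {q : ℝ} (hq : 0 < q)
    (h : ∀ s : Ioo (0 : ℝ) 1, localLip (quantileFn μ) s
      ≤ ENNReal.ofReal ((min (s : ℝ) (1 - (s : ℝ))) ^ (-1 - 1 / q))) (z : ℝ) :
    SlopeLE (gaussTransport μ) z (millsConst ^ (-1 - 1 / q) * slopeEnvelope q z) := by
  have hu := cdf_gaussianReal_mem_Ioo z
  refine (slopeLE_gaussTransport (h ⟨_, hu⟩) ?_).mono (tails_rpow_mul_pdf_le hq z)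
  exact Real.rpow_nonneg (le_min hu.1.le (by linarith [hu.2])) _

end GaussianTransport

/-! ### Truncated moments of the slope envelope -/

section GaussianEstimates

theorem lintegral_gaussianReal_comp_abs_le {g : ℝ → ℝ≥0∞} (hg : Measurable g) :
    ∫⁻ z, g |z| ∂(gaussianReal 0 1) ≤
      2 * ∫⁻ z in Ici (0 : ℝ), g z * ENNReal.ofReal (Real.exp (-z ^ 2 / 2)) := by
  have h1 : ∀ s : Set ℝ, MeasurableSet s → ∫⁻ z in s, g z ∂(gaussianReal 0 1) ≤
      ∫⁻ z in s, g z * ENNReal.ofReal (Real.exp (-z ^ 2 / 2)) := by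
    intro s hs
    rw [gaussianReal_of_var_ne_zero 0 one_ne_zero, restrict_withDensity hs,
      lintegral_withDensity_eq_lintegral_mul _ (measurable_gaussianPDF 0 1) hg]
    refine lintegral_mono fun z => ?_
    rw [Pi.mul_apply, mul_comm]
    refine mul_le_mul_right (ENNReal.ofReal_le_ofReal ?_) _
    rw [gaussianPDFReal_zero_one]
    have : (√(2 * Real.pi))⁻¹ ≤ 1 := by
      refine inv_le_one_of_one_le₀ (Real.one_le_sqrt.2 ?_)
      linarith [Real.pi_gt_three]
    exact mul_le_of_le_one_left (Real.exp_pos _).le this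
  have hpos : ∫⁻ z in Ici (0 : ℝ), g |z| ∂(gaussianReal 0 1) =
      ∫⁻ z in Ici (0 : ℝ), g z ∂(gaussianReal 0 1) :=
    setLIntegral_congr_fun measurableSet_Ici fun z hz => by
      rw [abs_of_nonneg hz]
  have hneg : ∫⁻ z in Iic (0 : ℝ), g |z| ∂(gaussianReal 0 1) =
      ∫⁻ z in Ici (0 : ℝ), g z ∂(gaussianReal 0 1) := by
    have hmap := gaussianReal_map_neg (μ := 0) (v := 1)
    rw [neg_zero] at hmap
    conv_lhs => rw [← hmap]
    rw [setLIntegral_map measurableSet_Iic (by fun_prop) measurable_neg, ← hpos]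
    have : (fun x : ℝ => -x) ⁻¹' Iic 0 = Ici 0 := by
      ext x; simp
    rw [this]
    simp_rw [abs_neg]
  calc ∫⁻ z, g |z| ∂(gaussianReal 0 1)
      = ∫⁻ z in Ici 0 ∪ Iic 0, g |z| ∂(gaussianReal 0 1) := by
        rw [union_comm, Iic_union_Ici, setLIntegral_univ]
    _ ≤ _ := lintegral_union_le _ _ _
    _ = 2 * ∫⁻ z in Ici (0 : ℝ), g z ∂(gaussianReal 0 1) := by rw [hpos, hneg, two_mul]
    _ ≤ _ := mul_le_mul_right (h1 _ measurableSet_Ici) _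

theorem one_add_rpow_le_exp {a y : ℝ} (ha : 0 ≤ a) (hy : 0 ≤ y) :
    (1 + y) ^ a ≤ Real.exp (a * y) := by
  rw [mul_comm, Real.exp_mul]
  gcongr
  linarith [Real.add_one_le_exp y]

theorem lintegral_exp_neg_mul_sub_Ici {c : ℝ} (hc : 0 < c) (R : ℝ) :
    ∫⁻ z in Ici R, ENNReal.ofReal (Real.exp (-c * (z - R))) = ENNReal.ofReal (1 / c) := by
  rw [setLIntegral_congr Ioi_ae_eq_Ici.symm, ← ofReal_integral_eq_lintegral_ofReal]
  · congr 1
    have h : ∀ z : ℝ, Real.exp (-c * (z - R)) = Real.exp (c * R) * Real.exp (-c * z) := by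
      intro z; rw [← Real.exp_add]; congr 1; ring
    simp_rw [h]
    rw [integral_const_mul, integral_exp_mul_Ioi (by linarith), neg_div_neg_eq, mul_div_assoc',
      ← Real.exp_add]
    simp
  · have h : ∀ z : ℝ, Real.exp (-c * (z - R)) = Real.exp (c * R) * Real.exp (-c * z) := by
      intro z; rw [← Real.exp_add]; congr 1; ring
    simp_rw [h]
    exact (exp_neg_integrableOn_Ioi R hc).const_mul _
  · exact ae_of_all _ fun z => (Real.exp_pos _).le

theorem slopeEnvelope_rpow {q : ℝ} (s z : ℝ) :
    slopeEnvelope q z ^ s = (1 + |z|) ^ (s * (1 + 1 / q)) * Real.exp (s / q * (z ^ 2 / 2)) := by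
  rw [slopeEnvelope, Real.mul_rpow (by positivity) (Real.exp_pos _).le,
    ← Real.rpow_mul (by positivity), ← Real.exp_mul]
  congr 2
  · ring
  · ring

theorem measurable_slopeEnvelope (q : ℝ) : Measurable (slopeEnvelope q) := by
  unfold slopeEnvelope
  fun_prop

theorem slopeEnvelope_abs (q z : ℝ) : slopeEnvelope q |z| = slopeEnvelope q z := by
  simp [slopeEnvelope]

/-- Because s < q, the Gaussian wins: past R the integrand is dominated by an exponential of rate
proportional to 1+R, so the integral is comparable to the value at R divided by 1+R. -/
theorem lintegral_slopeEnvelope_large {s q : ℝ} (hs : 0 < s) (hsq : s < q) :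
    ∃ C, 0 < C ∧ ∀ R, 0 ≤ R →
      ∫⁻ z, (if R ≤ |z| then ENNReal.ofReal (slopeEnvelope q z ^ s) else 0) ∂(gaussianReal 0 1)
        ≤ ENNReal.ofReal (C * (slopeEnvelope q R ^ s * (Real.exp (-R ^ 2 / 2) / (1 + R)))) := by
  have hq : 0 < q := hs.trans hsq
  set a := s * (1 + 1 / q) with ha
  have ha0 : 0 < a := by positivity
  set b := 1 - s / q with hb
  have hb0 : 0 < b := by
    rw [hb, sub_pos, div_lt_one hq]; exact hsq
  -- The maximum over y of (a+b)y - by²/2, exponentiated: the surplus left after extracting decay at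
  -- rate b(1+R).
  set C1 := Real.exp ((a + b) ^ 2 / (2 * b)) with hC1
  refine ⟨2 * (C1 / b), by positivity, fun R hR => ?_⟩
  have hpt : ∀ z ∈ Ici R, slopeEnvelope q z ^ s * Real.exp (-z ^ 2 / 2) ≤
      (C1 * ((1 + R) ^ a * Real.exp (-b * (R ^ 2 / 2)))) *
        Real.exp (-(b * (1 + R)) * (z - R)) := by
    intro z hz
    have hzR : 0 ≤ z - R := sub_nonneg.2 hz
    have hz0 : 0 ≤ z := hR.trans hz
    rw [slopeEnvelope_rpow, abs_of_nonneg hz0, mul_assoc, ← Real.exp_add]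
    have h1 : (1 + z) ^ a ≤ (1 + R) ^ a * Real.exp (a * (z - R)) := by
      refine le_trans ?_ (mul_le_mul_of_nonneg_left (one_add_rpow_le_exp ha0.le hzR)
        (by positivity))
      rw [← Real.mul_rpow (by positivity) (by positivity)]
      gcongr
      nlinarith
    refine (mul_le_mul_of_nonneg_right h1 (Real.exp_pos _).le).trans ?_
    have h2 : Real.exp (a * (z - R)) * Real.exp (s / q * (z ^ 2 / 2) + -z ^ 2 / 2) ≤
        C1 * Real.exp (-b * (R ^ 2 / 2)) * Real.exp (-(b * (1 + R)) * (z - R)) := by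
      rw [hC1, ← Real.exp_add, ← Real.exp_add, ← Real.exp_add]
      refine Real.exp_le_exp.2 ?_
      set y := z - R with hy
      have hzy : z = R + y := by rw [hy]; ring
      have hsb : s / q = 1 - b := by rw [hb]; ring
      rw [hsb, hzy]
      have h3 : (a + b) * y ≤ (a + b) ^ 2 / (2 * b) + b / 2 * y ^ 2 := by
        have : 0 ≤ (b * y - (a + b)) ^ 2 / (2 * b) := by positivity
        have h4 : (b * y - (a + b)) ^ 2 / (2 * b) = b / 2 * y ^ 2 - (a + b) * y +
          (a + b) ^ 2 / (2 * b) := by field_simp; ring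
        linarith
      linarith
    calc _ = (1 + R) ^ a * (Real.exp (a * (z - R)) *
          Real.exp (s / q * (z ^ 2 / 2) + -z ^ 2 / 2)) := by ring
      _ ≤ (1 + R) ^ a * (C1 * Real.exp (-b * (R ^ 2 / 2)) *
          Real.exp (-(b * (1 + R)) * (z - R))) := by gcongr
      _ = _ := by ring
  set g : ℝ → ℝ≥0∞ := fun z => if R ≤ z then ENNReal.ofReal (slopeEnvelope q z ^ s) else 0 with hg
  have hgm : Measurable g := by
    refine Measurable.ite measurableSet_Ici ?_ measurable_const
    exact ((measurable_slopeEnvelope q).pow_const s).ennreal_ofReal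
  have h0 := lintegral_gaussianReal_comp_abs_le hgm
  simp only [hg, slopeEnvelope_abs] at h0
  refine h0.trans ?_
  have h5 : ∫⁻ z in Ici (0 : ℝ), (if R ≤ z then ENNReal.ofReal (slopeEnvelope q z ^ s) else 0) *
      ENNReal.ofReal (Real.exp (-z ^ 2 / 2)) ≤
      ∫⁻ z in Ici R, ENNReal.ofReal ((C1 * ((1 + R) ^ a * Real.exp (-b * (R ^ 2 / 2)))) *
        Real.exp (-(b * (1 + R)) * (z - R))) := by
    rw [← lintegral_indicator measurableSet_Ici, ← lintegral_indicator measurableSet_Ici]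
    refine lintegral_mono fun z => ?_
    by_cases hz : R ≤ z
    · have hz0 : (0 : ℝ) ≤ z := hR.trans hz
      rw [indicator_of_mem (show z ∈ Ici (0 : ℝ) from hz0), indicator_of_mem (show z ∈ Ici R from hz),
        if_pos hz, ← ENNReal.ofReal_mul (Real.rpow_nonneg (slopeEnvelope_nonneg q z) s)]
      exact ENNReal.ofReal_le_ofReal (hpt z hz)
    · simp [indicator, hz]
  refine (mul_le_mul_right h5 _).trans ?_
  simp_rw [ENNReal.ofReal_mul (show 0 ≤ C1 * ((1 + R) ^ a * Real.exp (-b * (R ^ 2 / 2))) by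
    positivity)]
  rw [lintegral_const_mul' _ _ ENNReal.ofReal_ne_top,
    lintegral_exp_neg_mul_sub_Ici (by positivity), ← ENNReal.ofReal_mul (by positivity),
    show (2 : ℝ≥0∞) = ENNReal.ofReal 2 by simp, ← ENNReal.ofReal_mul (by norm_num)]
  refine ENNReal.ofReal_le_ofReal (le_of_eq ?_)
  rw [slopeEnvelope_rpow, abs_of_nonneg hR, ← ha]
  have h6 : Real.exp (-b * (R ^ 2 / 2)) = Real.exp (s / q * (R ^ 2 / 2)) *
      Real.exp (-R ^ 2 / 2) := by
    rw [← Real.exp_add]; congr 1; rw [hb]; ring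
  rw [h6]
  field_simp

/-- At the power 2q the envelope beats the Gaussian: the integrand becomes (1+z)^{2q+2} e^{z²/2},
which increases, so the endpoint R dominates. -/
theorem lintegral_slopeEnvelope_small {q : ℝ} (hq : 0 < q) {R : ℝ} (hR : 0 ≤ R) :
    ∫⁻ z, (if |z| < R then ENNReal.ofReal (slopeEnvelope q z ^ (2 * q)) else 0)
      ∂(gaussianReal 0 1)
      ≤ ENNReal.ofReal (4 * (slopeEnvelope q R ^ (2 * q) * (Real.exp (-R ^ 2 / 2) / (1 + R)))) := by
  set a := 2 * q + 2 with ha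
  have haq : 2 * q * (1 + 1 / q) = a := by rw [ha]; field_simp
  have hsq : 2 * q / q = 2 := by field_simp
  set g : ℝ → ℝ≥0∞ := fun z => if z < R then ENNReal.ofReal (slopeEnvelope q z ^ (2 * q)) else 0
    with hg
  have hgm : Measurable g := by
    refine Measurable.ite measurableSet_Iio ?_ measurable_const
    exact ((measurable_slopeEnvelope q).pow_const _).ennreal_ofReal
  have h0 := lintegral_gaussianReal_comp_abs_le hgm
  simp only [hg, slopeEnvelope_abs] at h0
  refine h0.trans ?_
  set H : ℝ → ℝ := fun z => (1 + z) ^ a * Real.exp (z ^ 2 / 2) with hH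
  have hHc : Continuous H := by
    have : Continuous fun z : ℝ => (1 + z) ^ a :=
      (Real.continuous_rpow_const (by positivity)).comp (by fun_prop)
    simp only [hH]
    fun_prop
  have h5 : ∫⁻ z in Ici (0 : ℝ), (if z < R then ENNReal.ofReal (slopeEnvelope q z ^ (2 * q)) else 0) *
      ENNReal.ofReal (Real.exp (-z ^ 2 / 2)) ≤ ∫⁻ z in Ioc 0 R, ENNReal.ofReal (H z) := by
    rw [setLIntegral_congr (Ico_ae_eq_Ioc (a := (0 : ℝ)) (b := R)).symm,
      ← lintegral_indicator measurableSet_Ici, ← lintegral_indicator measurableSet_Ico]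
    refine lintegral_mono fun z => ?_
    by_cases hz0 : 0 ≤ z
    · by_cases hz : z < R
      · rw [indicator_of_mem (show z ∈ Ici (0 : ℝ) from hz0),
          indicator_of_mem (show z ∈ Ico 0 R from ⟨hz0, hz⟩), if_pos hz,
          ← ENNReal.ofReal_mul (Real.rpow_nonneg (slopeEnvelope_nonneg q z) _)]
        refine ENNReal.ofReal_le_ofReal (le_of_eq ?_)
        rw [slopeEnvelope_rpow, haq, hsq, abs_of_nonneg hz0, mul_assoc, ← Real.exp_add]
        simp only [hH]
        congr 2
        ring
      · simp [indicator, hz]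
    · simp [indicator, hz0]
  -- An explicit near-antiderivative: its derivative dominates H, so the integral is at most G R.
  set G : ℝ → ℝ := fun z => 2 * ((1 + z) ^ (a - 1) * Real.exp (z ^ 2 / 2)) with hG
  set G' : ℝ → ℝ := fun z => 2 * ((a - 1) * (1 + z) ^ (a - 1 - 1) * Real.exp (z ^ 2 / 2) +
    (1 + z) ^ (a - 1) * (Real.exp (z ^ 2 / 2) * z)) with hG'
  have hderiv : ∀ z ∈ uIcc 0 R, HasDerivAt G (G' z) z := by
    intro z hz
    rw [uIcc_of_le hR] at hz
    have h1 : HasDerivAt (fun z : ℝ => (1 + z) ^ (a - 1)) ((a - 1) * (1 + z) ^ (a - 1 - 1)) z := by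
      have := ((hasDerivAt_id z).const_add 1).rpow_const (p := a - 1)
        (Or.inl (by have := hz.1; simp only [id]; positivity))
      simpa using this
    have h2 : HasDerivAt (fun z : ℝ => Real.exp (z ^ 2 / 2)) (Real.exp (z ^ 2 / 2) * z) z := by
      have := (((hasDerivAt_id z).pow 2).div_const 2).exp
      simpa using this
    exact (h1.mul h2).const_mul 2
  have hG'c : Continuous G' := by
    have h1 : Continuous fun z : ℝ => (1 + z) ^ (a - 1) :=
      (Real.continuous_rpow_const (by rw [ha]; linarith)).comp (by fun_prop)
    have h2 : Continuous fun z : ℝ => (1 + z) ^ (a - 1 - 1) :=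
      (Real.continuous_rpow_const (by rw [ha]; linarith)).comp (by fun_prop)
    simp only [hG']
    fun_prop
  have hle : ∀ z ∈ Icc 0 R, H z ≤ G' z := by
    intro z hz
    have hz0 : 0 ≤ z := hz.1
    have h1 : (1 + z) ^ a = (1 + z) ^ (a - 1 - 1) * (1 + z) ^ 2 := by
      rw [← Real.rpow_natCast, ← Real.rpow_add (by positivity)]; congr 1; push_cast; ring
    have h2 : (1 + z) ^ (a - 1) = (1 + z) ^ (a - 1 - 1) * (1 + z) := by
      rw [← Real.rpow_add_one (by positivity)]; congr 1; ring
    simp only [hH, hG']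
    rw [h1, h2]
    have h3 : 0 < (1 + z) ^ (a - 1 - 1) * Real.exp (z ^ 2 / 2) := by positivity
    have h4 : (1 + z) ^ 2 ≤ 2 * ((a - 1) + (1 + z) * z) := by
      rw [ha]; nlinarith
    nlinarith
  have h6 : ∫⁻ z in Ioc 0 R, ENNReal.ofReal (H z) ≤ ENNReal.ofReal (G R) := by
    rw [← ofReal_integral_eq_lintegral_ofReal ((hHc.integrableOn_Icc).mono_set Ioc_subset_Icc_self)]
    · refine ENNReal.ofReal_le_ofReal ?_
      rw [← intervalIntegral.integral_of_le hR]
      refine (intervalIntegral.integral_mono_on hR (hHc.intervalIntegrable _ _)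
        (hG'c.intervalIntegrable _ _) hle).trans ?_
      rw [intervalIntegral.integral_eq_sub_of_hasDerivAt hderiv (hG'c.intervalIntegrable _ _)]
      have : 0 ≤ G 0 := by simp only [hG]; positivity
      linarith
    · refine (ae_restrict_iff' measurableSet_Ioc).2 (ae_of_all _ fun z hz => ?_)
      have := hz.1.le
      simp only [hH, Pi.zero_apply]
      positivity
  refine (mul_le_mul_right (h5.trans h6) _).trans ?_
  rw [show (2 : ℝ≥0∞) = ENNReal.ofReal 2 by simp, ← ENNReal.ofReal_mul (by norm_num)]
  refine ENNReal.ofReal_le_ofReal (le_of_eq ?_)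
  rw [slopeEnvelope_rpow, haq, hsq, abs_of_nonneg hR]
  simp only [hG]
  have h7 : (1 + R) ^ a = (1 + R) ^ (a - 1) * (1 + R) := by
    rw [← Real.rpow_add_one (by positivity)]; congr 1; ring
  have h8 : Real.exp (2 * (R ^ 2 / 2)) * Real.exp (-R ^ 2 / 2) = Real.exp (R ^ 2 / 2) := by
    rw [← Real.exp_add]; congr 1; ring
  rw [h7, ← h8]
  field_simp
  ring

end GaussianEstimates

/-! ### Sums of envelopes averaged over an event that is not too rare -/

section SumsOverEvents

/-- The standard Gaussian measure on `Fin n → ℝ`, as a product measure. -/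
noncomputable abbrev gaussPi (n : ℕ) : Measure (Fin n → ℝ) := Measure.pi fun _ => gaussianReal 0 1

theorem lintegral_gaussPi_eval {n : ℕ} (i : Fin n) {g : ℝ → ℝ≥0∞} (hg : Measurable g) :
    ∫⁻ z, g (z i) ∂(gaussPi n) = ∫⁻ z, g z ∂(gaussianReal 0 1) := by
  rw [← (measurePreserving_eval (fun _ : Fin n => gaussianReal 0 1) i).map_eq,
    lintegral_map hg (by fun_prop)]

theorem lintegral_gaussPi_prod {n : ℕ} (A : Finset (Fin n)) {g : ℝ → ℝ≥0∞} (hg : Measurable g) :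
    ∫⁻ z, ∏ i ∈ A, g (z i) ∂(gaussPi n) = (∫⁻ z, g z ∂(gaussianReal 0 1)) ^ A.card := by
  have hind : iIndepFun (fun (i : Fin n) (z : Fin n → ℝ) => g (z i)) (gaussPi n) :=
    iIndepFun_pi fun _ => hg.aemeasurable
  rw [lintegral_prod_eq_prod_lintegral_of_indepFun A _ hind
    (fun i => hg.comp (measurable_pi_apply i))]
  simp_rw [lintegral_gaussPi_eval _ hg]
  rw [Finset.prod_const]

/-- For y ≤ p the linear term suffices; past p the function e^y / y^p increases, so it can be
compared with its value at Y. -/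
theorem exp_le_of_le {p Y y : ℝ} (hp : 0 < p) (hy : 0 ≤ y) (hyY : y ≤ Y) :
    Real.exp y ≤ 1 + Real.exp p * y + Real.exp Y * (y / Y) ^ p := by
  have hnn : 0 ≤ Real.exp Y * (y / Y) ^ p := by
    have : 0 ≤ y / Y := div_nonneg hy (hy.trans hyY)
    positivity
  rcases le_total y p with h | h
  · have h1 : Real.exp y ≤ 1 + Real.exp y * y := by
      have h2 := Real.add_one_le_exp (-y)
      have h3 : Real.exp (-y) * Real.exp y = 1 := by rw [← Real.exp_add]; simp
      nlinarith [Real.exp_pos y]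
    have h4 : Real.exp y * y ≤ Real.exp p * y := by gcongr
    linarith
  · have hy0 : 0 < y := hp.trans_le h
    have hY0 : 0 < Y := hy0.trans_le hyY
    have h1 : Real.exp y ≤ Real.exp Y * (y / Y) ^ p := by
      rw [Real.rpow_def_of_pos (by positivity), ← Real.exp_add]
      refine Real.exp_le_exp.2 ?_
      have h2 : Real.log (Y / y) ≤ Y / y - 1 := Real.log_le_sub_one_of_pos (by positivity)
      have h3 : Real.log (y / Y) = -Real.log (Y / y) := by
        rw [← Real.log_inv, inv_div]
      have h4 : Real.log (Y / y) * p ≤ Y - y := by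
        have h5 : 0 ≤ Real.log (Y / y) := Real.log_nonneg ((one_le_div hy0).2 hyY)
        calc Real.log (Y / y) * p ≤ Real.log (Y / y) * y := by gcongr
          _ ≤ (Y / y - 1) * y := by gcongr
          _ = Y - y := by field_simp
      rw [h3]
      linarith
    have : 0 ≤ Real.exp p * y := by positivity
    linarith

/-- Entropy duality in elementary form: S is at most Y+Γ plus e^{S-(Y+Γ)}, and the last term has
total integral at most e^{-Y}, hence at most the mass of B. -/
theorem setLIntegral_le_of_lintegral_exp_le {Ω : Type*} [MeasurableSpace Ω] {P : Measure Ω}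
    {S : Ω → ℝ} {B : Set Ω} {Γ Y : ℝ} (hΓ : 0 ≤ Γ) (hY : 0 ≤ Y)
    (hexp : ∫⁻ ω, ENNReal.ofReal (Real.exp (S ω)) ∂P ≤ ENNReal.ofReal (Real.exp Γ))
    (hB : ENNReal.ofReal (Real.exp (-Y)) ≤ P B) :
    ∫⁻ ω in B, ENNReal.ofReal (S ω) ∂P ≤ ENNReal.ofReal (Y + Γ + 1) * P B := by
  have hpt : ∀ ω, ENNReal.ofReal (S ω) ≤ ENNReal.ofReal (Y + Γ) +
      ENNReal.ofReal (Real.exp (-(Y + Γ))) * ENNReal.ofReal (Real.exp (S ω)) := by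
    intro ω
    rw [← ENNReal.ofReal_mul (Real.exp_pos _).le, ← Real.exp_add,
      ← ENNReal.ofReal_add (by positivity) (Real.exp_pos _).le]
    refine ENNReal.ofReal_le_ofReal ?_
    linarith [Real.add_one_le_exp (-(Y + Γ) + S ω)]
  calc ∫⁻ ω in B, ENNReal.ofReal (S ω) ∂P
      ≤ ∫⁻ ω in B, (ENNReal.ofReal (Y + Γ) +
        ENNReal.ofReal (Real.exp (-(Y + Γ))) * ENNReal.ofReal (Real.exp (S ω))) ∂P :=
        lintegral_mono hpt
    _ = ENNReal.ofReal (Y + Γ) * P B + ENNReal.ofReal (Real.exp (-(Y + Γ))) *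
          ∫⁻ ω in B, ENNReal.ofReal (Real.exp (S ω)) ∂P := by
        rw [lintegral_add_left measurable_const, setLIntegral_const,
          lintegral_const_mul' _ _ ENNReal.ofReal_ne_top]
    _ ≤ ENNReal.ofReal (Y + Γ) * P B + ENNReal.ofReal (Real.exp (-(Y + Γ))) *
          ENNReal.ofReal (Real.exp Γ) := by
        gcongr
        exact (setLIntegral_le_lintegral _ _).trans hexp
    _ ≤ ENNReal.ofReal (Y + Γ) * P B + P B := by
        gcongr
        rw [← ENNReal.ofReal_mul (Real.exp_pos _).le, ← Real.exp_add]
        rwa [show -(Y + Γ) + Γ = -Y by ring]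
    _ = _ := by
        rw [ENNReal.ofReal_add (by positivity) zero_le_one, ENNReal.ofReal_one, add_mul, one_mul]

theorem exists_truncation_level {L : ℝ} (hL : 1 ≤ L) :
    ∃ R, 0 ≤ R ∧ (1 + R) * Real.exp (R ^ 2 / 2) = L := by
  have hc : ContinuousOn (fun R : ℝ => (1 + R) * Real.exp (R ^ 2 / 2)) (Icc 0 L) := by fun_prop
  have h := intermediate_value_Icc (by linarith : (0 : ℝ) ≤ L) hc
  have hmem : L ∈ Icc ((fun R : ℝ => (1 + R) * Real.exp (R ^ 2 / 2)) 0)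
      ((fun R : ℝ => (1 + R) * Real.exp (R ^ 2 / 2)) L) := by
    constructor
    · simpa using hL
    · have : 1 ≤ Real.exp (L ^ 2 / 2) := Real.one_le_exp (by positivity)
      simp only
      nlinarith
  obtain ⟨R, hR, hRL⟩ := h hmem
  exact ⟨R, hR.1, hRL⟩

/-- If 1+R is at most a multiple of t, the defining equation of R gives the second term. Otherwise
t²/2 is a small fraction of R², and the room between s/q and 1 absorbs the polynomial factor,
leaving a multiple of k. -/
theorem slopeEnvelope_level_le {s q : ℝ} (hs : 0 < s) (hsq : s < q) :
    ∃ C, 0 < C ∧ ∀ k t R : ℝ, 1 ≤ k → 0 < t → 0 ≤ R →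
      (1 + R) * Real.exp (R ^ 2 / 2) = k * Real.exp (t ^ 2 / 2) →
      slopeEnvelope q R ^ s ≤ C * (k + k ^ (s / q) * t ^ s * Real.exp (s / q * (t ^ 2 / 2))) := by
  have hq : 0 < q := hs.trans hsq
  set a := s * (1 + 1 / q) with ha
  have ha0 : 0 < a := by positivity
  set b := 1 - s / q with hb
  have hb0 : 0 < b := by
    rw [hb, sub_pos, div_lt_one hq]; exact hsq
  set D : ℝ := √(4 / b) with hD
  have hD0 : 0 < D := by positivity
  have hD2 : D ^ 2 = 4 / b := Real.sq_sqrt (by positivity)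
  refine ⟨D ^ s + Real.exp (a ^ 2 / b + b / 4), by positivity, fun k t R hk ht hR heq => ?_⟩
  have hk0 : 0 < k := by linarith
  have hx : 0 ≤ k ^ (s / q) * t ^ s * Real.exp (s / q * (t ^ 2 / 2)) := by positivity
  rcases le_total (1 + R) (D * t) with h | h
  · have h1 : slopeEnvelope q R ^ s =
        (1 + R) ^ s * ((1 + R) * Real.exp (R ^ 2 / 2)) ^ (s / q) := by
      rw [slopeEnvelope_rpow, abs_of_nonneg hR, Real.mul_rpow (by positivity) (Real.exp_pos _).le,
        ← Real.exp_mul, ← mul_assoc, ← Real.rpow_add (by positivity)]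
      congr 2
      · field_simp
      · ring
    have h2 : slopeEnvelope q R ^ s ≤
        D ^ s * (k ^ (s / q) * t ^ s * Real.exp (s / q * (t ^ 2 / 2))) := by
      rw [h1, heq, Real.mul_rpow hk0.le (Real.exp_pos _).le, ← Real.exp_mul]
      calc _ ≤ (D * t) ^ s * (k ^ (s / q) * Real.exp (t ^ 2 / 2 * (s / q))) := by gcongr
        _ = _ := by
          rw [Real.mul_rpow hD0.le ht.le, mul_comm (t ^ 2 / 2)]; ring
    have h3 : 0 ≤ D ^ s := by positivity
    have h4 := Real.exp_pos (a ^ 2 / b + b / 4)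
    nlinarith [mul_nonneg h3 hk0.le, mul_nonneg h4.le (add_nonneg hk0.le hx)]
  · have h1 : slopeEnvelope q R ^ s ≤ Real.exp (a * R + s / q * (R ^ 2 / 2)) := by
      rw [slopeEnvelope_rpow, abs_of_nonneg hR, Real.exp_add]
      gcongr
      exact one_add_rpow_le_exp ha0.le hR
    have ht2 : t ^ 2 / 2 ≤ b / 4 * (1 + R ^ 2) := by
      have h2 : (D * t) ^ 2 ≤ (1 + R) ^ 2 := by gcongr
      rw [mul_pow, hD2, div_mul_eq_mul_div, div_le_iff₀ hb0] at h2
      nlinarith [sq_nonneg (1 - R)]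
    have h3 : Real.exp (R ^ 2 / 2) ≤ k * Real.exp (t ^ 2 / 2) := by
      rw [← heq]
      nlinarith [Real.exp_pos (R ^ 2 / 2)]
    have h4 : slopeEnvelope q R ^ s ≤ Real.exp (a ^ 2 / b + b / 4) * k := by
      have h5 : Real.exp (a * R + s / q * (R ^ 2 / 2)) ≤
          Real.exp (a ^ 2 / b + b / 4) * (Real.exp (R ^ 2 / 2) * Real.exp (-(t ^ 2 / 2))) := by
        rw [← Real.exp_add, ← Real.exp_add]
        refine Real.exp_le_exp.2 ?_
        have hsb : s / q = 1 - b := by rw [hb]; ring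
        have h6 : a * R ≤ a ^ 2 / b + b / 4 * R ^ 2 := by
          have : 0 ≤ (b * R - 2 * a) ^ 2 / (4 * b) := by positivity
          have h7 : (b * R - 2 * a) ^ 2 / (4 * b) = b / 4 * R ^ 2 - a * R + a ^ 2 / b := by
            field_simp; ring
          linarith
        rw [hsb]
        linarith
      refine h1.trans (h5.trans ?_)
      gcongr
      rw [Real.exp_neg, ← div_eq_mul_inv, div_le_iff₀ (Real.exp_pos _)]
      exact h3
    have h5 : 0 ≤ D ^ s := by positivity
    have h6 := Real.exp_pos (a ^ 2 / b + b / 4)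
    nlinarith [mul_nonneg h6.le hx, mul_nonneg h5 (add_nonneg hk0.le hx)]

/-- Truncate w^s at the level R where k Gaussian tails have total size about e^{-t²/2}. The part
above R is bounded by its unconditional mean, already at most a multiple of w(R)^s e^{-t²/2}. The
part below is bounded, so independence and an exponential moment apply, through
`setLIntegral_le_of_lintegral_exp_le`. -/
theorem sum_setLIntegral_slopeEnvelope_le {s q : ℝ} (hs : 0 < s) (hsq : s < q) :
    ∃ C, 0 < C ∧ ∀ (n : ℕ) (A : Finset (Fin n)) (B : Set (Fin n → ℝ)) (t : ℝ), 2 ≤ t →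
      ENNReal.ofReal (Real.exp (-(t ^ 2 / 2))) ≤ gaussPi n B →
      ∑ i ∈ A, ∫⁻ z in B, ENNReal.ofReal (slopeEnvelope q (z i) ^ s) ∂(gaussPi n) ≤
        ENNReal.ofReal (C * ((A.card : ℝ) + (A.card : ℝ) ^ (s / q) * t ^ s *
          Real.exp (s / q * (t ^ 2 / 2)))) * gaussPi n B := by
  have hq : 0 < q := hs.trans hsq
  obtain ⟨C₁, hC₁, hlarge⟩ := lintegral_slopeEnvelope_large hs hsq
  obtain ⟨C₂, hC₂, hlevel⟩ := slopeEnvelope_level_le hs hsq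
  -- Chosen so that (w^s)^p = w^{2q}, the power for which the truncated moment is governed by R.
  set p := 2 * q / s with hp
  have hp0 : 0 < p := by positivity
  have hps : s * p = 2 * q := by rw [hp]; field_simp
  set D := Real.exp p * C₁ with hD
  have hD0 : 0 < D := by positivity
  have hmean : ∫⁻ z, ENNReal.ofReal (slopeEnvelope q z ^ s) ∂(gaussianReal 0 1) ≤
      ENNReal.ofReal C₁ := by
    have h := hlarge 0 le_rfl
    simpa [abs_nonneg, slopeEnvelope] using h
  refine ⟨(C₁ + 6) * C₂ + D, by positivity, fun n A B t ht hB => ?_⟩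
  rcases A.eq_empty_or_nonempty with rfl | hA
  · simp
  set k : ℝ := (A.card : ℝ) with hk
  have hk1 : 1 ≤ k := by
    rw [hk]; exact_mod_cast hA.card_pos
  have hk0 : 0 < k := by linarith
  set Y := t ^ 2 / 2 with hY
  have hY1 : 2 ≤ Y := by rw [hY]; nlinarith
  have hY0 : 0 < Y := by linarith
  clear_value k Y
  obtain ⟨R, hR, hRL⟩ := exists_truncation_level
    (one_le_mul_of_one_le_of_one_le hk1 (Real.one_le_exp hY0.le))
  set m := slopeEnvelope q R ^ s with hm
  have hEpos : ∀ z, 0 < slopeEnvelope q z := fun z => by unfold slopeEnvelope; positivity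
  have hm0 : 0 < m := Real.rpow_pos_of_pos (hEpos R) s
  have hmle := hlevel k t R hk1 (by linarith) hR (by rw [hRL, hY])
  rw [← hY] at hmle
  have htail : Real.exp (-R ^ 2 / 2) / (1 + R) = Real.exp (-Y) / k := by
    rw [neg_div, Real.exp_neg, Real.exp_neg]
    field_simp
    linarith
  set W : ℝ → ℝ := fun z => slopeEnvelope q z ^ s with hW
  have hWm : Measurable W := (measurable_slopeEnvelope q).pow_const s
  have hW0 : ∀ z, 0 ≤ W z := fun z => Real.rpow_nonneg (slopeEnvelope_nonneg q z) s
  set W' : ℝ → ℝ := fun z => if |z| < R then W z else 0 with hW'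
  have hW'm : Measurable W' :=
    Measurable.ite (measurableSet_lt (by fun_prop) measurable_const) hWm measurable_const
  have hW'0 : ∀ z, 0 ≤ W' z := fun z => by
    simp only [hW']; split_ifs; exacts [hW0 z, le_rfl]
  have hW'W : ∀ z, W' z ≤ W z := fun z => by
    simp only [hW']; split_ifs; exacts [le_rfl, hW0 z]
  have hW'le : ∀ z, W' z ≤ m := by
    intro z
    simp only [hW']
    split_ifs with hz
    · refine Real.rpow_le_rpow (slopeEnvelope_nonneg q z) ?_ hs.le
      unfold slopeEnvelope
      rw [← sq_abs z, abs_of_nonneg hR]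
      gcongr
    · exact hm0.le
  set U : ℝ → ℝ≥0∞ := fun z => if R ≤ |z| then ENNReal.ofReal (W z) else 0 with hU
  have hUm : Measurable U :=
    Measurable.ite (measurableSet_le measurable_const (by fun_prop)) hWm.ennreal_ofReal
      measurable_const
  have hsplit : ∀ z, ENNReal.ofReal (W z) = U z + ENNReal.ofReal (W' z) := by
    intro z
    simp only [hU, hW']
    rcases lt_or_ge |z| R with h | h
    · simp [h, not_le.2 h]
    · simp [h, not_lt.2 h]
  have hUsum : ∑ i ∈ A, ∫⁻ z in B, U (z i) ∂(gaussPi n) ≤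
      ENNReal.ofReal (C₁ * m) * gaussPi n B := by
    calc ∑ i ∈ A, ∫⁻ z in B, U (z i) ∂(gaussPi n)
        ≤ ∑ i ∈ A, ENNReal.ofReal (C₁ * (m * (Real.exp (-Y) / k))) := by
          refine Finset.sum_le_sum fun i _ => (setLIntegral_le_lintegral _ _).trans ?_
          rw [lintegral_gaussPi_eval i hUm, ← htail]
          exact hlarge R hR
      _ = ENNReal.ofReal (C₁ * m) * ENNReal.ofReal (Real.exp (-Y)) := by
          rw [Finset.sum_const, nsmul_eq_mul, ← ENNReal.ofReal_natCast,
            ← ENNReal.ofReal_mul (by positivity), ← ENNReal.ofReal_mul (by positivity)]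
          congr 1
          rw [← hk]
          field_simp
      _ ≤ _ := by gcongr
  -- The largest θ for which θ times the truncated variable stays below Y. The p-th moment term then
  -- contributes e^Y · 4e^{-Y}/k = 4/k, harmless after k factors.
  set θ := Y / m with hθ
  have hθ0 : 0 < θ := by positivity
  have hmgf1 : ∫⁻ z, ENNReal.ofReal (Real.exp (θ * W' z)) ∂(gaussianReal 0 1) ≤
      ENNReal.ofReal (Real.exp (D * θ + 4 / k)) := by
    have hpt : ∀ z, ENNReal.ofReal (Real.exp (θ * W' z)) ≤ ENNReal.ofReal 1 +
        ENNReal.ofReal (Real.exp p * θ) * ENNReal.ofReal (W z) +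
        ENNReal.ofReal (Real.exp Y * (m ^ p)⁻¹) *
          (if |z| < R then ENNReal.ofReal (slopeEnvelope q z ^ (2 * q)) else 0) := by
      intro z
      have h1 : θ * W' z ≤ Y := by
        calc θ * W' z ≤ θ * m := by gcongr; exact hW'le z
          _ = Y := by rw [hθ]; field_simp
      have h2 := exp_le_of_le hp0 (mul_nonneg hθ0.le (hW'0 z)) h1
      have h3 : θ * W' z / Y = W' z / m := by rw [hθ]; field_simp
      have h4 : ENNReal.ofReal (W' z ^ p) =
          if |z| < R then ENNReal.ofReal (slopeEnvelope q z ^ (2 * q)) else 0 := by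
        simp only [hW', hW]
        split_ifs
        · rw [← Real.rpow_mul (slopeEnvelope_nonneg q z), hps]
        · rw [Real.zero_rpow hp0.ne', ENNReal.ofReal_zero]
      rw [h3, Real.div_rpow (hW'0 z) hm0.le] at h2
      have h6 : 0 ≤ W' z ^ p := Real.rpow_nonneg (hW'0 z) p
      rw [← h4, ← ENNReal.ofReal_mul (by positivity), ← ENNReal.ofReal_mul (by positivity),
        ← ENNReal.ofReal_add zero_le_one (mul_nonneg (by positivity) (hW0 z)),
        ← ENNReal.ofReal_add (add_nonneg zero_le_one (mul_nonneg (by positivity) (hW0 z)))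
          (by positivity)]
      refine ENNReal.ofReal_le_ofReal (h2.trans ?_)
      have h5 : Real.exp p * (θ * W' z) ≤ Real.exp p * θ * W z := by
        rw [mul_assoc]
        have := hW'W z
        gcongr
      rw [div_eq_mul_inv, mul_comm (W' z ^ p), ← mul_assoc]
      linarith
    have hmeas : Measurable fun z : ℝ => ENNReal.ofReal 1 +
        ENNReal.ofReal (Real.exp p * θ) * ENNReal.ofReal (W z) :=
      (hWm.ennreal_ofReal.const_mul _).const_add _
    calc _ ≤ ENNReal.ofReal 1 + ENNReal.ofReal (Real.exp p * θ) * ENNReal.ofReal C₁ +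
          ENNReal.ofReal (Real.exp Y * (m ^ p)⁻¹) * ENNReal.ofReal (4 *
            (slopeEnvelope q R ^ (2 * q) * (Real.exp (-R ^ 2 / 2) / (1 + R)))) := by
          refine (lintegral_mono hpt).trans ?_
          rw [lintegral_add_left hmeas, lintegral_add_left measurable_const,
            lintegral_const_mul' _ _ ENNReal.ofReal_ne_top,
            lintegral_const_mul' _ _ ENNReal.ofReal_ne_top, lintegral_const, measure_univ, mul_one]
          gcongr
          exact lintegral_slopeEnvelope_small hq hR
      _ = ENNReal.ofReal (1 + D * θ + 4 / k) := by
          have hmp : slopeEnvelope q R ^ (2 * q) = m ^ p := by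
            rw [hm, ← Real.rpow_mul (slopeEnvelope_nonneg q R), hps]
          have hmp0 : 0 < m ^ p := by positivity
          rw [htail, hmp, ← ENNReal.ofReal_mul (by positivity), ← ENNReal.ofReal_mul (by positivity),
            ← ENNReal.ofReal_add zero_le_one (by positivity),
            ← ENNReal.ofReal_add (by positivity) (by positivity)]
          congr 1
          rw [Real.exp_neg, hD]
          field_simp
      _ ≤ _ := by
          refine ENNReal.ofReal_le_ofReal ?_
          linarith [Real.add_one_le_exp (D * θ + 4 / k)]
  have hmgf : ∫⁻ z, ENNReal.ofReal (Real.exp (∑ i ∈ A, θ * W' (z i))) ∂(gaussPi n) ≤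
      ENNReal.ofReal (Real.exp (k * (D * θ) + 4)) := by
    calc _ = ∫⁻ z, ∏ i ∈ A, ENNReal.ofReal (Real.exp (θ * W' (z i))) ∂(gaussPi n) := by
          refine lintegral_congr fun z => ?_
          rw [Real.exp_sum, ENNReal.ofReal_prod_of_nonneg fun i _ => (Real.exp_pos _).le]
      _ = (∫⁻ z, ENNReal.ofReal (Real.exp (θ * W' z)) ∂(gaussianReal 0 1)) ^ A.card :=
          lintegral_gaussPi_prod A (g := fun z => ENNReal.ofReal (Real.exp (θ * W' z)))
            ((hW'm.const_mul θ).exp.ennreal_ofReal)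
      _ ≤ (ENNReal.ofReal (Real.exp (D * θ + 4 / k))) ^ A.card := by gcongr
      _ = _ := by
          rw [← ENNReal.ofReal_pow (Real.exp_pos _).le, ← Real.exp_nat_mul, ← hk]
          congr 2
          field_simp
  have hyoung := setLIntegral_le_of_lintegral_exp_le
    (show 0 ≤ k * (D * θ) + 4 by positivity) hY0.le hmgf hB
  have hW'sum : ∑ i ∈ A, ∫⁻ z in B, ENNReal.ofReal (W' (z i)) ∂(gaussPi n) ≤
      ENNReal.ofReal (6 * m + D * k) * gaussPi n B := by
    have h1 : ∑ i ∈ A, ∫⁻ z in B, ENNReal.ofReal (W' (z i)) ∂(gaussPi n) =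
        ENNReal.ofReal θ⁻¹ * ∫⁻ z in B, ENNReal.ofReal (∑ i ∈ A, θ * W' (z i)) ∂(gaussPi n) := by
      have hmeas : ∀ i ∈ A, Measurable fun z : Fin n → ℝ => ENNReal.ofReal (W' (z i)) :=
        fun i _ => (hW'm.comp (measurable_pi_apply i)).ennreal_ofReal
      rw [← lintegral_finsetSum _ hmeas, ← lintegral_const_mul' _ _ ENNReal.ofReal_ne_top]
      refine lintegral_congr fun z => ?_
      rw [← ENNReal.ofReal_mul (by positivity), ← Finset.mul_sum, inv_mul_cancel_left₀ hθ0.ne',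
        ENNReal.ofReal_sum_of_nonneg fun i _ => hW'0 (z i)]
    rw [h1]
    refine (mul_le_mul_right hyoung _).trans ?_
    rw [← mul_assoc, ← ENNReal.ofReal_mul (by positivity)]
    refine mul_le_mul_left (ENNReal.ofReal_le_ofReal ?_) _
    have h2 : θ⁻¹ * (Y + (k * (D * θ) + 4) + 1) = m + m * (5 / Y) + D * k := by
      rw [hθ]; field_simp; ring
    rw [h2]
    have h3 : 5 / Y ≤ 5 := by
      rw [div_le_iff₀ hY0]; linarith
    nlinarith
  calc ∑ i ∈ A, ∫⁻ z in B, ENNReal.ofReal (W (z i)) ∂(gaussPi n)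
      = ∑ i ∈ A, ∫⁻ z in B, U (z i) ∂(gaussPi n) +
          ∑ i ∈ A, ∫⁻ z in B, ENNReal.ofReal (W' (z i)) ∂(gaussPi n) := by
        rw [← Finset.sum_add_distrib]
        refine Finset.sum_congr rfl fun i _ => ?_
        simp_rw [hsplit]
        exact lintegral_add_left (hUm.comp (measurable_pi_apply i)) _
    _ ≤ _ := add_le_add hUsum hW'sum
    _ = ENNReal.ofReal ((C₁ + 6) * m + D * k) * gaussPi n B := by
        rw [← add_mul, ← ENNReal.ofReal_add (by positivity) (by positivity)]
        congr 2
        ring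
    _ ≤ _ := by
        refine mul_le_mul_left (ENNReal.ofReal_le_ofReal ?_) _
        have hx : 0 ≤ k ^ (s / q) * t ^ s * Real.exp (s / q * Y) := by positivity
        have h1 : (C₁ + 6) * m ≤ (C₁ + 6) * (C₂ * (k + k ^ (s / q) * t ^ s *
          Real.exp (s / q * Y))) := mul_le_mul_of_nonneg_left hmle (by positivity)
        nlinarith [mul_nonneg hD0.le hx]

end SumsOverEvents

/-! ### Convex sublevel sets of large Gaussian measure -/

section ConvexSublevel

open scoped NNReal

/-- A product of two nonnegative convex functions that both increase with |x| is convex. -/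
theorem convexOn_slopeEnvelope_rpow {s q : ℝ} (hs : 1 ≤ s) (hq : 0 < q) :
    ConvexOn ℝ univ fun x => slopeEnvelope q x ^ s := by
  have ha : 1 ≤ s * (1 + 1 / q) := by
    have : 0 < 1 / q := by positivity
    nlinarith
  set a := s * (1 + 1 / q)
  have hsq : 0 < s / q := by positivity
  have h1 : ConvexOn ℝ univ fun x : ℝ => (1 + |x|) ^ a := by
    refine ⟨convex_univ, fun x _ y _ c d hc hd hcd => ?_⟩
    have h2 := (convexOn_rpow ha).2 (show 1 + |x| ∈ Ici 0 from by simp; positivity)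
      (show 1 + |y| ∈ Ici 0 from by simp; positivity) hc hd hcd
    refine le_trans ?_ h2
    simp only [smul_eq_mul]
    refine Real.rpow_le_rpow (by positivity) ?_ (by linarith)
    calc 1 + |c * x + d * y| ≤ 1 + (|c * x| + |d * y|) := by gcongr; exact abs_add_le _ _
      _ = c * (1 + |x|) + d * (1 + |y|) := by
        rw [abs_mul, abs_mul, abs_of_nonneg hc, abs_of_nonneg hd]; linear_combination -hcd
  have h3 : ConvexOn ℝ univ fun x : ℝ => Real.exp (s / q * (x ^ 2 / 2)) := by
    refine ⟨convex_univ, fun x _ y _ c d hc hd hcd => ?_⟩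
    have h2 := convexOn_exp.2 (mem_univ (s / q * (x ^ 2 / 2))) (mem_univ (s / q * (y ^ 2 / 2)))
      hc hd hcd
    refine le_trans (Real.exp_le_exp.2 ?_) h2
    have h4 := (even_two.convexOn_pow (𝕜 := ℝ)).2
      (mem_univ x) (mem_univ y) hc hd hcd
    simp only [smul_eq_mul] at h4 ⊢
    nlinarith
  have h5 := h1.mul h3 (fun x _ => by positivity) (fun x _ => by positivity) (by
    intro x _ y _ hxy
    simp only at hxy
    rw [Real.exp_lt_exp, mul_lt_mul_iff_right₀ hsq, div_lt_div_iff_of_pos_right (by norm_num),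
      sq_lt_sq] at hxy
    simp only
    gcongr)
  simp_rw [slopeEnvelope_rpow]
  exact h5

theorem convex_sublevel_slopeEnvelope {n : ℕ} {s q : ℝ} (hs : 1 ≤ s) (hq : 0 < q) {c : Fin n → ℝ}
    (hc : ∀ i, 0 ≤ c i) (lam : ℝ) :
    Convex ℝ {z : EuclideanSpace ℝ (Fin n) | ∑ i, c i * slopeEnvelope q (z i) ^ s ≤ lam} := by
  intro x hx y hy a b ha hb hab
  simp only [mem_ofPred_eq] at hx hy ⊢
  calc ∑ i, c i * slopeEnvelope q ((a • x + b • y) i) ^ s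
      ≤ ∑ i, (a * (c i * slopeEnvelope q (x i) ^ s) + b * (c i * slopeEnvelope q (y i) ^ s)) := by
        refine Finset.sum_le_sum fun i _ => ?_
        have h := (convexOn_slopeEnvelope_rpow hs hq).2 (mem_univ (x i)) (mem_univ (y i)) ha hb hab
        simp only [smul_eq_mul] at h
        have h2 := mul_le_mul_of_nonneg_left h (hc i)
        simp only [PiLp.add_apply, PiLp.smul_apply, smul_eq_mul]
        linarith
    _ = a * ∑ i, c i * slopeEnvelope q (x i) ^ s + b * ∑ i, c i * slopeEnvelope q (y i) ^ s := by
        rw [Finset.sum_add_distrib, Finset.mul_sum, Finset.mul_sum]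
    _ ≤ a * lam + b * lam := by gcongr
    _ = lam := by rw [← add_mul, hab, one_mul]

/-- If the superlevel set had larger mass, the hypothesis would bound the mean over it by Λ,
although the sum exceeds 2Λ at each of its points. -/
theorem stdGaussian_superlevel_le {n : ℕ} {s q t Λ : ℝ} (hΛ : 0 < Λ) {c : Fin n → ℝ}
    (hc : ∀ i, 0 ≤ c i)
    (h : ∀ B : Set (Fin n → ℝ), ENNReal.ofReal (Real.exp (-(t ^ 2 / 2))) ≤ gaussPi n B →
      ∑ i, ENNReal.ofReal (c i) *
        ∫⁻ z in B, ENNReal.ofReal (slopeEnvelope q (z i) ^ s) ∂(gaussPi n) ≤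
          ENNReal.ofReal Λ * gaussPi n B) :
    stdGaussian (EuclideanSpace ℝ (Fin n))
      {z : EuclideanSpace ℝ (Fin n) | ∑ i, c i * slopeEnvelope q (z i) ^ s ≤ 2 * Λ}ᶜ
        ≤ ENNReal.ofReal (Real.exp (-t ^ 2 / 2)) := by
  have hEm : Measurable fun z => slopeEnvelope q z ^ s := (measurable_slopeEnvelope q).pow_const s
  have hE0 : ∀ z, 0 ≤ slopeEnvelope q z ^ s := fun z => Real.rpow_nonneg (slopeEnvelope_nonneg q z) s
  set B : Set (Fin n → ℝ) := {z | ∑ i, c i * slopeEnvelope q (z i) ^ s ≤ 2 * Λ}ᶜ with hB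
  have hSm : Measurable fun z : Fin n → ℝ => ∑ i, c i * slopeEnvelope q (z i) ^ s :=
    Finset.measurable_sum _ fun i _ => (hEm.comp (measurable_pi_apply i)).const_mul _
  have hBm : MeasurableSet B := (measurableSet_le hSm measurable_const).compl
  rw [← map_pi_eq_stdGaussian, Measure.map_apply (by fun_prop) ?_]
  · change gaussPi n B ≤ _
    by_contra! hlt
    rw [neg_div] at hlt
    have h1 := h B hlt.le
    have h2 : ENNReal.ofReal (2 * Λ) * gaussPi n B ≤ ∑ i, ENNReal.ofReal (c i) *
        ∫⁻ z in B, ENNReal.ofReal (slopeEnvelope q (z i) ^ s) ∂(gaussPi n) := by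
      have hmeas : ∀ i ∈ (Finset.univ : Finset (Fin n)), Measurable fun z : Fin n → ℝ =>
          ENNReal.ofReal (c i) * ENNReal.ofReal (slopeEnvelope q (z i) ^ s) := fun i _ =>
        ((hEm.comp (measurable_pi_apply i)).ennreal_ofReal).const_mul _
      simp_rw [← lintegral_const_mul' _ _ ENNReal.ofReal_ne_top]
      rw [← lintegral_finsetSum _ hmeas, ← setLIntegral_const]
      refine setLIntegral_mono' hBm fun z hz => ?_
      simp_rw [← ENNReal.ofReal_mul (hc _)]
      rw [← ENNReal.ofReal_sum_of_nonneg fun i _ => mul_nonneg (hc i) (hE0 _)]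
      simp only [hB, mem_compl_iff, mem_ofPred_eq, not_le] at hz
      exact ENNReal.ofReal_le_ofReal hz.le
    have hpos : 0 < gaussPi n B := lt_of_le_of_lt bot_le hlt
    have h3 := (ENNReal.mul_le_mul_iff_left hpos.ne' (measure_ne_top _ _)).1 (h2.trans h1)
    rw [ENNReal.ofReal_le_ofReal_iff hΛ.le] at h3
    linarith
  · refine (measurableSet_le ?_ measurable_const).compl
    exact Finset.measurable_sum _ fun i _ => (hEm.comp (by fun_prop)).const_mul _

end ConvexSublevel

/-! ### Transfer from the Gaussian space to X -/

section Transfer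

open scoped NNReal

theorem measure_eq_stdGaussian {n : ℕ} {μ : Fin n → Measure ℝ} [∀ i, IsProbabilityMeasure (μ i)]
    {Ω : Type*} [MeasurableSpace Ω] {P : Measure Ω} {X : Fin n → Ω → ℝ}
    (hX : ∀ i, HasLaw (X i) (μ i) P) (hind : iIndepFun X P) {S : Set (Fin n → ℝ)}
    (hS : MeasurableSet S) :
    P {ω | (fun i => X i ω) ∈ S} = stdGaussian (EuclideanSpace ℝ (Fin n))
      {z | (fun i => gaussTransport (μ i) (z i)) ∈ S} := by
  have hXm : AEMeasurable (fun ω i => X i ω) P := aemeasurable_pi_lambda _ fun i => (hX i).aemeasurable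
  have hT : Measurable fun (z : Fin n → ℝ) i => gaussTransport (μ i) (z i) :=
    measurable_pi_lambda _ fun i => (measurable_gaussTransport (μ i)).comp (measurable_pi_apply i)
  have hE : Measurable fun (z : EuclideanSpace ℝ (Fin n)) i => gaussTransport (μ i) (z i) :=
    measurable_pi_lambda _ fun i => (measurable_gaussTransport (μ i)).comp (by fun_prop)
  have h1 : P.map (fun ω i => X i ω) = Measure.pi μ := by
    have hprob : IsProbabilityMeasure P := hind.isProbabilityMeasure
    rw [(iIndepFun_iff_map_fun_eq_pi_map fun i => (hX i).aemeasurable).1 hind]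
    congr 1
    ext1 i
    exact (hX i).map_eq
  have h2 : (gaussPi n).map (fun z i => gaussTransport (μ i) (z i)) = Measure.pi μ := by
    have : ∀ i, SigmaFinite ((gaussianReal 0 1).map (gaussTransport (μ i))) := fun i => by
      rw [map_gaussTransport]; infer_instance
    rw [gaussPi, Measure.pi_map_pi (μ := fun _ : Fin n => gaussianReal 0 1)
      fun i => (measurable_gaussTransport (μ i)).aemeasurable]
    congr 1
    ext1 i
    exact map_gaussTransport (μ i)
  calc P {ω | (fun i => X i ω) ∈ S} = Measure.pi μ S := by
        rw [← h1, Measure.map_apply_of_aemeasurable hXm hS]; rfl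
    _ = _ := by
        rw [← h2, Measure.map_apply hT hS, ← map_pi_eq_stdGaussian]
        exact (Measure.map_apply (by fun_prop) (hE hS)).symm

/-- The common core of both inequalities: only the weights c, the power s, the level Λ and the slope
bound M remain to be chosen. -/
theorem deviation_le_of_slope_le {n : ℕ} {q s : ℝ} (hq : 0 < q) (hs : 1 ≤ s)
    {μ : Fin n → Measure ℝ} [∀ i, IsProbabilityMeasure (μ i)]
    (hμ : ∀ (i : Fin n) (u : Ioo (0 : ℝ) 1), localLip (quantileFn (μ i)) u
      ≤ ENNReal.ofReal ((min (u : ℝ) (1 - (u : ℝ))) ^ (-1 - 1 / q)))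
    {f : (Fin n → ℝ) → ℝ} (hf : Differentiable ℝ f)
    {Ω : Type*} [MeasurableSpace Ω] {P : Measure Ω} {X : Fin n → Ω → ℝ}
    (hX : ∀ i, HasLaw (X i) (μ i) P) (hind : iIndepFun X P)
    {m : ℝ} (hm : IsMedian P (fun ω => f (fun i => X i ω)) m)
    {t Λ : ℝ} (ht : 2 ≤ t) (hΛ : 0 < Λ) {c : Fin n → ℝ} (hc : ∀ i, 0 ≤ c i)
    (h : ∀ B : Set (Fin n → ℝ), ENNReal.ofReal (Real.exp (-(t ^ 2 / 2))) ≤ gaussPi n B →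
      ∑ i, ENNReal.ofReal (c i) *
        ∫⁻ z in B, ENNReal.ofReal (slopeEnvelope q (z i) ^ s) ∂(gaussPi n) ≤
          ENNReal.ofReal Λ * gaussPi n B)
    {M : ℝ} (hM : 0 < M)
    (hslope : ∀ (x : Fin n → ℝ) (e : Fin n → ℝ), (∀ i, 0 ≤ e i) → ∑ i, c i * e i ^ s ≤ 2 * Λ →
      √(∑ i, (partialD f i x * (millsConst ^ (-1 - 1 / q) * e i)) ^ 2) ≤ M) :
    P {ω | Real.pi / 2 * M * t < |f (fun i => X i ω) - m|} ≤
      ENNReal.ofReal (10 * Real.exp (-t ^ 2 / 2)) := by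
  lift M to ℝ≥0 using hM.le
  set G : EuclideanSpace ℝ (Fin n) → ℝ := fun z => f fun i => gaussTransport (μ i) (z i) with hG
  have hfm : Measurable f := hf.continuous.measurable
  have hK := convex_sublevel_slopeEnvelope (n := n) hs hq hc (2 * Λ)
  have hLip : LipschitzOnWith M G
      {z : EuclideanSpace ℝ (Fin n) | ∑ i, c i * slopeEnvelope q (z i) ^ s ≤ 2 * Λ} := by
    refine lipschitzOnWith_of_slopeLE hK fun z hz => ?_
    exact (slopeLE_comp_coord hf fun i => slopeLE_gaussTransport_envelope hq (hμ i) (z i)).mono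
      (hslope _ _ (fun i => slopeEnvelope_nonneg q (z i)) hz)
  have hmed : IsMedian (stdGaussian (EuclideanSpace ℝ (Fin n))) G m := by
    have h1 := measure_eq_stdGaussian hX hind (measurableSet_le hfm (measurable_const (a := m)))
    have h2 := measure_eq_stdGaussian hX hind (measurableSet_le (measurable_const (a := m)) hfm)
    exact ⟨hm.1.trans_eq h1, hm.2.trans_eq h2⟩
  have hdev := stdGaussian_deviation_le (NNReal.coe_pos.1 hM) hLip ht
    (stdGaussian_superlevel_le hΛ hc h) hmed
  have h3 := measure_eq_stdGaussian hX hind (S := {x | Real.pi / 2 * M * t < |f x - m|})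
    (measurableSet_lt measurable_const (hfm.sub_const m).abs)
  exact h3.trans_le hdev

/-- Allows thresholds strictly above the stated one, so M can be taken positive even when the norm
vanishes, and a gauge infimum need not be attained. -/
theorem measure_lt_le_of_forall_gt {Ω : Type*} [MeasurableSpace Ω] {P : Measure Ω} {Y : Ω → ℝ}
    {τ₀ : ℝ} {c : ℝ≥0∞} (h : ∀ τ, τ₀ < τ → P {ω | τ < Y ω} ≤ c) : P {ω | τ₀ < Y ω} ≤ c := by
  have hU : {ω | τ₀ < Y ω} = ⋃ k : ℕ, {ω | τ₀ + 1 / ((k : ℝ) + 1) < Y ω} := by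
    ext ω
    simp only [mem_ofPred_eq, mem_iUnion]
    constructor
    · intro hω
      obtain ⟨k, hk⟩ := exists_nat_one_div_lt (sub_pos.2 hω)
      exact ⟨k, by linarith⟩
    · rintro ⟨k, hk⟩
      have : 0 < 1 / ((k : ℝ) + 1) := by positivity
      linarith
  have hmono : Monotone fun k : ℕ => {ω | τ₀ + 1 / ((k : ℝ) + 1) < Y ω} := by
    intro j k hjk ω hω
    rw [mem_ofPred_eq] at hω ⊢
    refine lt_of_le_of_lt ?_ hω
    gcongr
  rw [hU, hmono.measure_iUnion]
  exact iSup_le fun k => h _ (by have : 0 < 1 / ((k : ℝ) + 1) := by positivity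
                                 linarith)

end Transfer

/-! ### Duality for the norm |·|_{r,s} -/

section MixedNorm

open scoped Pointwise

theorem ellNorm_sign {n : ℕ} {s : ℝ} (hs : 0 < s) {u : Fin n → ℝ}
    (hu : ∀ i, u i = 0 ∨ u i = 1 ∨ u i = -1) :
    ellNorm s u = ((Finset.univ.filter fun i => u i ≠ 0).card : ℝ) ^ (1 / s) := by
  rw [ellNorm]
  congr 1
  rw [Finset.card_filter]
  push_cast
  refine Finset.sum_congr rfl fun i _ => ?_
  rcases hu i with h | h | h <;> simp [h, Real.zero_rpow hs.ne']

theorem single_mem_convexHull_signVectors {n : ℕ} {r σ : ℝ} (hσ : 0 < σ) (i : Fin n) {ε : ℝ}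
    (hε : ε = 1 ∨ ε = -1) :
    (max 1 r)⁻¹ • Pi.single i ε ∈ convexHull ℝ (signVectors n r σ) := by
  refine subset_convexHull ℝ _ ?_
  have hε0 : ε ≠ 0 := by rcases hε with rfl | rfl <;> norm_num
  have hu : ∀ j, (Pi.single i ε : Fin n → ℝ) j = 0 ∨ (Pi.single i ε : Fin n → ℝ) j = 1 ∨
      (Pi.single i ε : Fin n → ℝ) j = -1 := by
    intro j
    rcases eq_or_ne j i with rfl | h
    · right; simpa using hε
    · left; simp [h]
  refine ⟨Pi.single i ε, hu, by simpa using hε0, ?_⟩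
  have hcard : (Finset.univ.filter fun j => (Pi.single i ε : Fin n → ℝ) j ≠ 0) = {i} := by
    ext j
    rcases eq_or_ne j i with rfl | h
    · simp [hε0]
    · simp [h]
  rw [ellNorm_sign one_pos hu, ellNorm_sign hσ hu, hcard]
  simp

/-- The gauge is a real infimum, which is 0 on the empty set; absorption by the hull shows that its
value is genuine. -/
theorem exists_mem_smul_convexHull_signVectors {n : ℕ} (hn : 1 ≤ n) {r σ : ℝ} (hσ : 0 < σ)
    (a : Fin n → ℝ) : ∃ b : ℝ, 0 < b ∧ a ∈ b • convexHull ℝ (signVectors n r σ) := by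
  set ρ := max 1 r with hρ
  have hρ0 : 0 < ρ := lt_max_of_lt_left one_pos
  set H := convexHull ℝ (signVectors n r σ)
  have hH : Convex ℝ H := convex_convexHull ℝ _
  set ε : Fin n → ℝ := fun i => if a i < 0 then -1 else 1 with hε
  have hmem : ∀ i, ρ⁻¹ • Pi.single i (ε i) ∈ H := fun i =>
    single_mem_convexHull_signVectors hσ i (by simp only [hε]; split_ifs <;> simp)
  have hεa : ∀ i, |a i| * ε i = a i := by
    intro i
    simp only [hε]
    split_ifs with h
    · rw [abs_of_neg h]; ring
    · rw [abs_of_nonneg (not_lt.1 h), mul_one]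
  set S := ∑ i, |a i| with hS
  have hS0 : 0 ≤ S := Finset.sum_nonneg fun _ _ => abs_nonneg _
  rcases hS0.eq_or_lt with h0 | hSpos
  · refine ⟨1, one_pos, ?_⟩
    have ha : a = 0 := by
      ext i
      have := (Finset.sum_eq_zero_iff_of_nonneg fun i _ => abs_nonneg (a i)).1 h0.symm i
        (Finset.mem_univ i)
      simpa using this
    rw [one_smul, ha]
    have hi : Fin n := ⟨0, hn⟩
    have h1 := single_mem_convexHull_signVectors (r := r) hσ hi (ε := 1) (Or.inl rfl)
    have h2 := single_mem_convexHull_signVectors (r := r) hσ hi (ε := -1) (Or.inr rfl)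
    have h3 := hH h1 h2 (a := 1 / 2) (b := 1 / 2) (by norm_num) (by norm_num) (by norm_num)
    convert h3 using 1
    rw [← smul_add, ← smul_add, ← Pi.single_add]
    simp
  · refine ⟨S * ρ, by positivity, ?_⟩
    have h1 : ∑ i, (|a i| / S) • (ρ⁻¹ • (Pi.single i (ε i) : Fin n → ℝ)) ∈ H :=
      hH.sum_mem (fun i _ => by positivity)
        (by rw [← Finset.sum_div, div_self hSpos.ne']) fun i _ => hmem i
    refine ⟨_, h1, ?_⟩
    ext j
    simp only [Pi.smul_apply, Finset.sum_apply, smul_eq_mul, Pi.single_apply, mul_ite, mul_zero,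
      Finset.sum_ite_eq, Finset.mem_univ, if_true]
    rw [show S * ρ * (|a j| / S * (ρ⁻¹ * ε j)) = |a j| * ε j by field_simp, hεa]

/-- The set of x with ∑|x_i| w_i ≤ c is convex, and the hypothesis on index sets says exactly that
it contains the generating sign vectors, hence their hull. -/
theorem sum_abs_mul_le_of_mixedNorm_lt {n : ℕ} (hn : 1 ≤ n) {r σ : ℝ} (hσ : 0 < σ)
    {w : Fin n → ℝ} (hw : ∀ i, 0 ≤ w i) {c : ℝ} (hc : 0 ≤ c)
    (hA : ∀ A : Finset (Fin n),
      ∑ i ∈ A, w i ≤ c * max (A.card : ℝ) (r * (A.card : ℝ) ^ (1 / σ)))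
    {a : Fin n → ℝ} {N : ℝ} (hN : mixedNorm r σ a < N) : ∑ i, |a i| * w i ≤ c * N := by
  have hne : {b : ℝ | b ∈ Ioi 0 ∧ a ∈ b • convexHull ℝ (signVectors n r σ)}.Nonempty := by
    obtain ⟨b, hb, hab⟩ := exists_mem_smul_convexHull_signVectors hn (r := r) hσ a
    exact ⟨b, hb, hab⟩
  obtain ⟨b, ⟨hb, y, hy, rfl⟩, hbN⟩ := exists_lt_of_csInf_lt hne hN
  have hb0 : 0 < b := hb
  have hconv : Convex ℝ {x : Fin n → ℝ | ∑ i, |x i| * w i ≤ c} := by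
    intro x hx z hz α β hα hβ hαβ
    simp only [mem_ofPred_eq] at hx hz ⊢
    calc ∑ i, |(α • x + β • z) i| * w i ≤ ∑ i, (α * (|x i| * w i) + β * (|z i| * w i)) := by
          refine Finset.sum_le_sum fun i _ => ?_
          have h : |(α • x + β • z) i| ≤ α * |x i| + β * |z i| := by
            simp only [Pi.add_apply, Pi.smul_apply, smul_eq_mul]
            refine (abs_add_le _ _).trans_eq ?_
            rw [abs_mul, abs_mul, abs_of_nonneg hα, abs_of_nonneg hβ]
          have := mul_le_mul_of_nonneg_right h (hw i)
          linarith
      _ = α * ∑ i, |x i| * w i + β * ∑ i, |z i| * w i := by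
          rw [Finset.sum_add_distrib, Finset.mul_sum, Finset.mul_sum]
      _ ≤ α * c + β * c := by gcongr
      _ = c := by rw [← add_mul, hαβ, one_mul]
  have hsub : signVectors n r σ ⊆ {x : Fin n → ℝ | ∑ i, |x i| * w i ≤ c} := by
    rintro v ⟨u, hu, hu0, rfl⟩
    set A := Finset.univ.filter fun i => u i ≠ 0 with hAdef
    have hcard : 0 < (A.card : ℝ) := by
      obtain ⟨i, hi⟩ := Function.ne_iff.1 hu0
      exact_mod_cast Finset.card_pos.2 ⟨i, by simpa [hAdef] using hi⟩
    rw [mem_ofPred_eq, ellNorm_sign one_pos hu, ellNorm_sign hσ hu, ← hAdef, div_one, Real.rpow_one]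
    set D := max (A.card : ℝ) (r * (A.card : ℝ) ^ (1 / σ)) with hD
    have hD0 : 0 < D := lt_max_of_lt_left hcard
    have h1 : ∑ i, |(D⁻¹ • u) i| * w i = D⁻¹ * ∑ i ∈ A, w i := by
      rw [Finset.mul_sum, hAdef, Finset.sum_filter]
      refine Finset.sum_congr rfl fun i _ => ?_
      rw [Pi.smul_apply, smul_eq_mul, abs_mul, abs_of_pos (inv_pos.2 hD0)]
      rcases hu i with h | h | h <;> simp [h]
    rw [h1, inv_mul_le_iff₀ hD0, mul_comm]
    exact hA A
  have hmem := convexHull_min hsub hconv hy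
  rw [mem_ofPred_eq] at hmem
  calc ∑ i, |(b • y) i| * w i = b * ∑ i, |y i| * w i := by
        rw [Finset.mul_sum]
        refine Finset.sum_congr rfl fun i _ => ?_
        rw [Pi.smul_apply, smul_eq_mul, abs_mul, abs_of_pos hb0, mul_assoc]
    _ ≤ b * c := by gcongr
    _ ≤ N * c := mul_le_mul_of_nonneg_right hbN.le hc
    _ = c * N := mul_comm _ _

theorem mixedNorm_nonneg {n : ℕ} (r σ : ℝ) (a : Fin n → ℝ) : 0 ≤ mixedNorm r σ a := gauge_nonneg a

end MixedNorm

/-! ### The two deviation inequalities for t ≥ 2 -/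

section MainBounds

theorem exists_mixedNorm_deviation {q : ℝ} (hq : 2 < q) :
    ∃ K : ℝ, 0 < K ∧ ∀ (n : ℕ) (_ : 1 ≤ n) (μ : Fin n → Measure ℝ)
      (_ : ∀ i, IsProbabilityMeasure (μ i))
      (_ : ∀ (i : Fin n) (s : Ioo (0 : ℝ) 1), localLip (quantileFn (μ i)) s
          ≤ ENNReal.ofReal ((min (s : ℝ) (1 - (s : ℝ))) ^ (-1 - 1 / q)))
      (f : (Fin n → ℝ) → ℝ) (_ : Differentiable ℝ f)
      (Ω : Type*) (_ : MeasurableSpace Ω) (P : Measure Ω)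
      (X : Fin n → Ω → ℝ) (_ : ∀ i, HasLaw (X i) (μ i) P) (_ : iIndepFun X P)
      (m : ℝ) (_ : IsMedian P (fun ω => f (fun i => X i ω)) m) (t : ℝ) (_ : 2 ≤ t)
      (a : Fin n → ℝ) (_ : ∀ i x, partialD f i x ^ 2 ≤ a i),
      P {ω | K * t * √(mixedNorm (10 * t ^ 2 * Real.exp (t ^ 2 / q)) (q / 2) a)
            < |f (fun i => X i ω) - m|}
          ≤ ENNReal.ofReal (10 * Real.exp (-t ^ 2 / 2)) := by
  have hq0 : 0 < q := by linarith
  obtain ⟨C, hC, hsum⟩ := sum_setLIntegral_slopeEnvelope_le two_pos hq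
  set D := millsConst ^ (-1 - 1 / q) with hD
  have hD0 : 0 < D := Real.rpow_pos_of_pos millsConst_pos _
  refine ⟨Real.pi / 2 * (D * √(4 * C)), by positivity, ?_⟩
  intro n hn μ hμp hμ f hf Ω _ P X hX hind m hm t ht a ha
  have ht0 : 0 < t := by linarith
  set K := Real.pi / 2 * (D * √(4 * C)) with hK
  have hK0 : 0 < K := by positivity
  set r := 10 * t ^ 2 * Real.exp (t ^ 2 / q) with hr
  have ha0 : ∀ i, 0 ≤ a i := fun i => (sq_nonneg _).trans (ha i 0)
  refine measure_lt_le_of_forall_gt fun τ hτ => ?_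
  have hN0 := mixedNorm_nonneg r (q / 2) a
  have hτ0 : 0 < τ := lt_of_le_of_lt (by positivity) hτ
  -- Defined so that K t √N = τ: the strict excess of τ over the threshold becomes the strict
  -- inequality needed for the gauge.
  set N := (τ / (K * t)) ^ 2 with hN
  have hNpos : 0 < N := by positivity
  have hlt : mixedNorm r (q / 2) a < N := by
    rw [hN, ← Real.sqrt_lt' (by positivity), lt_div_iff₀ (by positivity), mul_comm]
    exact hτ
  have hsqN : √N = τ / (K * t) := Real.sqrt_sq (by positivity)
  have hbound : ∀ B : Set (Fin n → ℝ), ENNReal.ofReal (Real.exp (-(t ^ 2 / 2))) ≤ gaussPi n B →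
      ∑ i, ENNReal.ofReal (a i) *
        ∫⁻ z in B, ENNReal.ofReal (slopeEnvelope q (z i) ^ (2 : ℝ)) ∂(gaussPi n) ≤
          ENNReal.ofReal (2 * C * N) * gaussPi n B := by
    intro B hB
    obtain ⟨β, hβ0, hβB⟩ : ∃ β : ℝ, 0 ≤ β ∧ gaussPi n B = ENNReal.ofReal β :=
      ⟨_, ENNReal.toReal_nonneg, (ENNReal.ofReal_toReal (measure_ne_top _ _)).symm⟩
    set w : Fin n → ℝ≥0∞ := fun i =>
      ∫⁻ z in B, ENNReal.ofReal (slopeEnvelope q (z i) ^ (2 : ℝ)) ∂(gaussPi n) with hw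
    have hwA := fun A : Finset (Fin n) => hsum n A B t ht hB
    have hwfin : ∀ i, w i ≠ ⊤ := by
      intro i
      have h := hwA {i}
      rw [Finset.sum_singleton] at h
      exact ne_top_of_le_ne_top (ENNReal.mul_ne_top ENNReal.ofReal_ne_top (measure_ne_top _ _)) h
    have hwr : ∀ i, w i = ENNReal.ofReal (w i).toReal := fun i =>
      (ENNReal.ofReal_toReal (hwfin i)).symm
    have hAr : ∀ A : Finset (Fin n), ∑ i ∈ A, (w i).toReal ≤
        (2 * C * β) * max (A.card : ℝ) (r * (A.card : ℝ) ^ (1 / (q / 2))) := by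
      intro A
      have h := hwA A
      change ∑ i ∈ A, w i ≤ _ at h
      generalize hk : (A.card : ℝ) = k at h ⊢
      have hk0 : 0 ≤ k := hk ▸ Nat.cast_nonneg _
      rw [Finset.sum_congr rfl fun i _ => hwr i,
        ← ENNReal.ofReal_sum_of_nonneg fun i _ => ENNReal.toReal_nonneg, hβB,
        ← ENNReal.ofReal_mul (by positivity), ENNReal.ofReal_le_ofReal_iff (by positivity)] at h
      refine h.trans ?_
      have h1 : 1 / (q / 2) = 2 / q := by field_simp
      have h2 : Real.exp (2 / q * (t ^ 2 / 2)) = Real.exp (t ^ 2 / q) := by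
        congr 1; field_simp
      rw [h1, h2, Real.rpow_two]
      have h3 : k ^ (2 / q) * t ^ 2 * Real.exp (t ^ 2 / q) ≤ r * k ^ (2 / q) := by
        have : 0 ≤ k ^ (2 / q) * t ^ 2 * Real.exp (t ^ 2 / q) := by positivity
        rw [hr]
        linarith
      have h4 := le_max_left k (r * k ^ (2 / q))
      have h5 := le_max_right k (r * k ^ (2 / q))
      calc C * (k + k ^ (2 / q) * t ^ 2 * Real.exp (t ^ 2 / q)) * β
          ≤ C * (2 * max k (r * k ^ (2 / q))) * β := by gcongr; linarith
        _ = _ := by ring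
    have hfin := sum_abs_mul_le_of_mixedNorm_lt hn (by positivity : 0 < q / 2)
      (fun i => ENNReal.toReal_nonneg) (by positivity) hAr hlt
    calc ∑ i, ENNReal.ofReal (a i) * w i = ENNReal.ofReal (∑ i, |a i| * (w i).toReal) := by
          rw [ENNReal.ofReal_sum_of_nonneg fun i _ =>
            mul_nonneg (abs_nonneg _) ENNReal.toReal_nonneg]
          refine Finset.sum_congr rfl fun i _ => ?_
          rw [abs_of_nonneg (ha0 i), ENNReal.ofReal_mul (ha0 i), ← hwr]
      _ ≤ ENNReal.ofReal (2 * C * β * N) := ENNReal.ofReal_le_ofReal hfin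
      _ = _ := by
          rw [hβB, ← ENNReal.ofReal_mul (by positivity)]
          congr 1; ring
  have hmain := deviation_le_of_slope_le hq0 one_le_two hμ hf hX hind hm ht
    (by positivity : 0 < 2 * C * N) ha0 hbound (M := D * √(4 * C) * √N) (by positivity) (by
    intro x e he hle
    refine Real.sqrt_le_iff.2 ⟨by positivity, ?_⟩
    calc ∑ i, (partialD f i x * (D * e i)) ^ 2 ≤ ∑ i, D ^ 2 * (a i * e i ^ (2 : ℝ)) := by
          refine Finset.sum_le_sum fun i _ => ?_
          rw [Real.rpow_two]
          calc (partialD f i x * (D * e i)) ^ 2 = D ^ 2 * (partialD f i x ^ 2 * e i ^ 2) := by ring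
            _ ≤ _ := by gcongr; exact ha i x
      _ = D ^ 2 * ∑ i, a i * e i ^ (2 : ℝ) := by rw [Finset.mul_sum]
      _ ≤ D ^ 2 * (2 * (2 * C * N)) := by gcongr
      _ = _ := by
          rw [mul_pow, mul_pow, Real.sq_sqrt (by positivity), Real.sq_sqrt hNpos.le]; ring)
  have hτeq : Real.pi / 2 * (D * √(4 * C) * √N) * t = τ := by
    calc _ = K * t * √N := by rw [hK]; ring
      _ = τ := by rw [hsqN]; field_simp
  rwa [hτeq] at hmain

theorem exists_gradLip_deviation {p q : ℝ} (hq : 2 < q) (hp : 2 * q / (q - 2) < p) :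
    ∃ K : ℝ, 0 < K ∧ ∀ (n : ℕ) (_ : 1 ≤ n) (μ : Fin n → Measure ℝ)
      (_ : ∀ i, IsProbabilityMeasure (μ i))
      (_ : ∀ (i : Fin n) (s : Ioo (0 : ℝ) 1), localLip (quantileFn (μ i)) s
          ≤ ENNReal.ofReal ((min (s : ℝ) (1 - (s : ℝ))) ^ (-1 - 1 / q)))
      (f : (Fin n → ℝ) → ℝ) (_ : Differentiable ℝ f)
      (Ω : Type*) (_ : MeasurableSpace Ω) (P : Measure Ω)
      (X : Fin n → Ω → ℝ) (_ : ∀ i, HasLaw (X i) (μ i) P) (_ : iIndepFun X P)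
      (m : ℝ) (_ : IsMedian P (fun ω => f (fun i => X i ω)) m) (t : ℝ) (_ : 2 ≤ t)
      (L : ℝ) (_ : 0 ≤ L) (_ : ∀ x, ellNorm p (fun i => partialD f i x) ≤ L),
      P {ω | K * L * ((n : ℝ) ^ (1 / 2 - 1 / p) * t
              + (n : ℝ) ^ (1 / q) * t ^ 2 * Real.exp (t ^ 2 / (2 * q)))
            < |f (fun i => X i ω) - m|}
          ≤ ENNReal.ofReal (10 * Real.exp (-t ^ 2 / 2)) := by
  have hq0 : 0 < q := by linarith
  have hq2 : 0 < q - 2 := by linarith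
  have hpq : 2 * q < p * (q - 2) := by rwa [div_lt_iff₀ hq2] at hp
  have hp2 : 2 < p := by
    refine lt_of_le_of_lt ?_ hp
    rw [le_div_iff₀ hq2]; linarith
  have hp0 : 0 < p := by linarith
  have hpm : 0 < p - 2 := by linarith
  -- Makes p/2 and s/2 conjugate exponents, so Hölder splits ∑ (∂_i f)² w_i² into an ℓ_p norm of the
  -- gradient and ∑ w_i^s.
  set s := 2 * p / (p - 2) with hs
  have hs0 : 0 < s := by positivity
  have hs2 : 2 ≤ s := by rw [hs, le_div_iff₀ hpm]; linarith
  have hsq : s < q := by rw [hs, div_lt_iff₀ hpm]; linarith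
  have hsp : 1 / s = 1 / 2 - 1 / p := by rw [hs]; field_simp
  obtain ⟨C, hC, hsum⟩ := sum_setLIntegral_slopeEnvelope_le hs0 hsq
  set D := millsConst ^ (-1 - 1 / q) with hD
  have hD0 : 0 < D := Real.rpow_pos_of_pos millsConst_pos _
  refine ⟨Real.pi / 2 * (D * (2 * C) ^ (1 / s)), by positivity, ?_⟩
  intro n hn μ hμp hμ f hf Ω _ P X hX hind m hm t ht L hL0 hL
  have ht0 : 0 < t := by linarith
  have hn0 : 0 < (n : ℝ) := by exact_mod_cast hn
  set K := Real.pi / 2 * (D * (2 * C) ^ (1 / s)) with hK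
  have hK0 : 0 < K := by positivity
  set S := (n : ℝ) ^ (1 / s) + (n : ℝ) ^ (1 / q) * t * Real.exp (t ^ 2 / (2 * q)) with hS
  have hS0 : 0 < S := by positivity
  have hSt : (n : ℝ) ^ (1 / 2 - 1 / p) * t + (n : ℝ) ^ (1 / q) * t ^ 2 * Real.exp (t ^ 2 / (2 * q))
      = S * t := by rw [hS, hsp]; ring
  rw [hSt]
  refine measure_lt_le_of_forall_gt fun τ hτ => ?_
  have hτ0 : 0 < τ := lt_of_le_of_lt (by positivity) hτ
  set N := τ / (K * (S * t)) with hN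
  have hNpos : 0 < N := by positivity
  have hLN : L ≤ N := by
    rw [hN, le_div_iff₀ (by positivity)]
    linarith
  set Λ := C * ((n : ℝ) + (n : ℝ) ^ (s / q) * t ^ s * Real.exp (s / q * (t ^ 2 / 2))) with hΛ
  have hΛ0 : 0 < Λ := by positivity
  -- Subadditivity of x ↦ x^{1/s}, valid as s ≥ 1, separates the two terms of the final bound.
  have hΛS : (2 * Λ) ^ (1 / s) ≤ (2 * C) ^ (1 / s) * S := by
    rw [hΛ, ← mul_assoc, Real.mul_rpow (by positivity) (by positivity)]
    gcongr
    refine (Real.rpow_add_le_add_rpow hn0.le (by positivity) (by positivity)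
      (by rw [div_le_one hs0]; linarith)).trans_eq ?_
    rw [hS, Real.mul_rpow (by positivity) (Real.exp_pos _).le,
      Real.mul_rpow (by positivity) (by positivity), ← Real.rpow_mul hn0.le,
      ← Real.rpow_mul ht0.le, ← Real.exp_mul]
    have h1 : s / q * (1 / s) = 1 / q := by field_simp
    have h2 : s * (1 / s) = 1 := by field_simp
    have h3 : s / q * (t ^ 2 / 2) * (1 / s) = t ^ 2 / (2 * q) := by field_simp
    rw [h1, h2, h3, Real.rpow_one]
  have hbound : ∀ B : Set (Fin n → ℝ), ENNReal.ofReal (Real.exp (-(t ^ 2 / 2))) ≤ gaussPi n B →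
      ∑ i, ENNReal.ofReal ((fun _ : Fin n => (1 : ℝ)) i) *
        ∫⁻ z in B, ENNReal.ofReal (slopeEnvelope q (z i) ^ s) ∂(gaussPi n) ≤
          ENNReal.ofReal Λ * gaussPi n B := by
    intro B hB
    have h := hsum n Finset.univ B t ht hB
    rw [Finset.card_univ, Fintype.card_fin] at h
    simpa only [ENNReal.ofReal_one, one_mul] using h
  have hmain := deviation_le_of_slope_le hq0 (by linarith : 1 ≤ s) hμ hf hX hind hm ht
    hΛ0 (c := fun _ => 1) (fun _ => zero_le_one) hbound (M := D * N * ((2 * C) ^ (1 / s) * S))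
    (by positivity) (by
    intro x e he hle
    simp only [one_mul] at hle
    have hconj : (p / 2).HolderConjugate (s / 2) := by
      rw [Real.holderConjugate_iff]
      refine ⟨by linarith, ?_⟩
      rw [hs]; field_simp; ring
    have hH := Real.inner_le_Lp_mul_Lq_of_nonneg Finset.univ hconj
      (f := fun i => |partialD f i x| ^ (2 : ℝ)) (g := fun i => e i ^ (2 : ℝ))
      (fun i _ => by positivity) (fun i _ => Real.rpow_nonneg (he i) _)
    have hf1 : ∀ i, (|partialD f i x| ^ (2 : ℝ)) ^ (p / 2) = |partialD f i x| ^ p := by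
      intro i
      rw [← Real.rpow_mul (abs_nonneg _)]; congr 1; ring
    have hg1 : ∀ i, (e i ^ (2 : ℝ)) ^ (s / 2) = e i ^ s := by
      intro i
      rw [← Real.rpow_mul (he i)]; congr 1; ring
    simp_rw [hf1, hg1] at hH
    have hdn : 0 ≤ ∑ i, |partialD f i x| ^ p := Finset.sum_nonneg fun i _ => by positivity
    have hen : 0 ≤ ∑ i, e i ^ s := Finset.sum_nonneg fun i _ => Real.rpow_nonneg (he i) _
    have h1 : (∑ i, |partialD f i x| ^ p) ^ (1 / (p / 2)) ≤ N ^ 2 := by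
      have h2 : (∑ i, |partialD f i x| ^ p) ^ (1 / (p / 2)) =
          (ellNorm p fun i => partialD f i x) ^ 2 := by
        rw [ellNorm, ← Real.rpow_natCast, ← Real.rpow_mul hdn]; congr 1; push_cast; field_simp
      rw [h2]
      have h3 : 0 ≤ ellNorm p fun i => partialD f i x := Real.rpow_nonneg hdn _
      gcongr
      exact (hL x).trans hLN
    have h4 : (∑ i, e i ^ s) ^ (1 / (s / 2)) ≤ ((2 * C) ^ (1 / s) * S) ^ 2 := by
      have h5 : (∑ i, e i ^ s) ^ (1 / (s / 2)) = ((∑ i, e i ^ s) ^ (1 / s)) ^ 2 := by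
        rw [← Real.rpow_natCast, ← Real.rpow_mul hen]; congr 1; push_cast; field_simp
      rw [h5]
      gcongr
      refine le_trans ?_ hΛS
      gcongr
    refine Real.sqrt_le_iff.2 ⟨by positivity, ?_⟩
    calc ∑ i, (partialD f i x * (D * e i)) ^ 2
        = D ^ 2 * ∑ i, |partialD f i x| ^ (2 : ℝ) * e i ^ (2 : ℝ) := by
          rw [Finset.mul_sum]
          refine Finset.sum_congr rfl fun i _ => ?_
          rw [Real.rpow_two, Real.rpow_two, sq_abs]; ring
      _ ≤ D ^ 2 * (N ^ 2 * ((2 * C) ^ (1 / s) * S) ^ 2) := by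
          gcongr
          refine hH.trans ?_
          gcongr
      _ = _ := by ring)
  have hτeq : Real.pi / 2 * (D * N * ((2 * C) ^ (1 / s) * S)) * t = τ := by
    calc _ = K * (S * t) * N := by rw [hK]; ring
      _ = τ := by rw [hN]; field_simp
  rwa [hτeq] at hmain

/-- Since e² ≤ 10, the stated probability bound exceeds 1 for t < 2, so only t ≥ 2 needs an
argument. -/
theorem one_le_ten_mul_exp {t : ℝ} (ht0 : 0 < t) (ht : t < 2) :
    1 ≤ 10 * Real.exp (-t ^ 2 / 2) := by
  have h1 : Real.exp (-2) ≤ Real.exp (-t ^ 2 / 2) := Real.exp_le_exp.2 (by nlinarith)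
  have h2 : Real.exp 2 ≤ 10 := by
    have := Real.exp_one_lt_d9
    rw [show (2 : ℝ) = 1 + 1 by norm_num, Real.exp_add]
    nlinarith [Real.exp_pos 1]
  have h3 : Real.exp (-2) * Real.exp 2 = 1 := by rw [← Real.exp_add]; simp
  nlinarith [Real.exp_pos (-2)]

end MainBounds

theorem mainTheorem2 :
    ∃ C : ℝ, 0 < C ∧ ∃ Cq : ℝ → ℝ, (∀ q, 0 < Cq q) ∧
    ∃ Cpq : ℝ → ℝ → ℝ, (∀ p q, 0 < Cpq p q) ∧
    ∀ (n : ℕ) (_ : 1 ≤ n) (q p : ℝ) (_ : 2 < q) (_ : 2 * q / (q - 2) < p)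
      (μ : Fin n → Measure ℝ) (_ : ∀ i, IsProbabilityMeasure (μ i))
      (_ : ∀ (i : Fin n) (s : Ioo (0 : ℝ) 1),
        localLip (quantileFn (μ i)) s
          ≤ ENNReal.ofReal ((min (s : ℝ) (1 - (s : ℝ))) ^ (-1 - 1 / q)))
      (f : (Fin n → ℝ) → ℝ) (_ : Differentiable ℝ f)
      (Ω : Type*) (_ : MeasurableSpace Ω) (P : Measure Ω) (_ : IsProbabilityMeasure P)
      (X : Fin n → Ω → ℝ) (_ : ∀ i, HasLaw (X i) (μ i) P) (_ : iIndepFun X P)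
      (m : ℝ) (_ : IsMedian P (fun ω => f (fun i => X i ω)) m)
      (t : ℝ) (_ : 0 < t),
      P {ω | ENNReal.ofReal (Cq q * t)
              * mixedNormTop (C * t ^ 2 * Real.exp (t ^ 2 / q)) (q / 2) (supSqPartials f)
                  ^ (1 / 2 : ℝ)
            < ENNReal.ofReal |f (fun i => X i ω) - m|}
          ≤ ENNReal.ofReal (C * Real.exp (-t ^ 2 / 2)) ∧
      P {ω | ENNReal.ofReal (Cpq p q) * gradLip p f
              * ENNReal.ofReal ((n : ℝ) ^ (1 / 2 - 1 / p) * t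
                  + (n : ℝ) ^ (1 / q) * t ^ 2 * Real.exp (t ^ 2 / (2 * q)))
            < ENNReal.ofReal |f (fun i => X i ω) - m|}
          ≤ ENNReal.ofReal (C * Real.exp (-t ^ 2 / 2)) := by
  classical
  -- The same 10 serves as the probability prefactor and in r. Outside the admissible range of
  -- exponents the constants default to 1, merely to be positive.
  refine ⟨10, by norm_num,
    fun q => if hq : 2 < q then (exists_mixedNorm_deviation hq).choose else 1, fun q => ?_,
    fun p q => if h : 2 < q ∧ 2 * q / (q - 2) < p then
      (exists_gradLip_deviation h.1 h.2).choose else 1, fun p q => ?_, ?_⟩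
  · dsimp only
    split_ifs with hq
    · exact (exists_mixedNorm_deviation hq).choose_spec.1
    · exact one_pos
  · dsimp only
    split_ifs with h
    · exact (exists_gradLip_deviation h.1 h.2).choose_spec.1
    · exact one_pos
  intro n hn q p hq hp μ hμp hμ f hf Ω _ P hP X hX hind m hm t ht0
  rcases lt_or_ge t 2 with ht | ht
  · have h1 : (1 : ℝ≥0∞) ≤ ENNReal.ofReal (10 * Real.exp (-t ^ 2 / 2)) :=
      ENNReal.one_le_ofReal.2 (one_le_ten_mul_exp ht0 ht)
    exact ⟨prob_le_one.trans h1, prob_le_one.trans h1⟩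
  dsimp only
  rw [dif_pos hq, dif_pos ⟨hq, hp⟩]
  obtain ⟨hK1, hdev1⟩ := (exists_mixedNorm_deviation hq).choose_spec
  obtain ⟨hK2, hdev2⟩ := (exists_gradLip_deviation hq hp).choose_spec
  set K₁ := (exists_mixedNorm_deviation hq).choose
  set K₂ := (exists_gradLip_deviation hq hp).choose
  constructor
  · by_cases hfin : ∀ i, supSqPartials f i ≠ ⊤
    · have ha : ∀ i x, partialD f i x ^ 2 ≤ (supSqPartials f i).toReal := by
        intro i x
        rw [← sq_abs, ← ENNReal.ofReal_le_iff_le_toReal (hfin i)]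
        exact le_iSup (fun x => ENNReal.ofReal (|partialD f i x| ^ 2)) x
      refine le_trans (measure_mono fun ω hω => ?_)
        (hdev1 n hn μ hμp hμ f hf Ω _ P X hX hind m hm t ht _ ha)
      rw [mem_ofPred_eq, mixedNormTop, if_pos hfin, ENNReal.ofReal_rpow_of_nonneg
        (mixedNorm_nonneg _ _ _) (by norm_num), ← ENNReal.ofReal_mul (by positivity),
        ← Real.sqrt_eq_rpow] at hω
      exact (ENNReal.ofReal_lt_ofReal_iff_of_nonneg (by positivity)).1 hω
    -- An infinite partial derivative bound makes the threshold infinite, because K₁ t is nonzero;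
    -- the event is then empty.
    · have htop : ENNReal.ofReal (K₁ * t) *
          mixedNormTop (10 * t ^ 2 * Real.exp (t ^ 2 / q)) (q / 2) (supSqPartials f)
            ^ (1 / 2 : ℝ) = ⊤ := by
        rw [mixedNormTop, if_neg hfin, ENNReal.top_rpow_of_pos (by norm_num), ENNReal.mul_top]
        exact (ENNReal.ofReal_pos.2 (by positivity)).ne'
      simp only [htop, not_top_lt, ofPred_false, measure_empty, zero_le]
  · have hn0 : 0 < (n : ℝ) := by exact_mod_cast hn
    have hS : 0 < (n : ℝ) ^ (1 / 2 - 1 / p) * t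
        + (n : ℝ) ^ (1 / q) * t ^ 2 * Real.exp (t ^ 2 / (2 * q)) := by positivity
    by_cases hfin : gradLip p f ≠ ⊤
    · have hL : ∀ x, ellNorm p (fun i => partialD f i x) ≤ (gradLip p f).toReal := by
        intro x
        rw [← ENNReal.ofReal_le_iff_le_toReal hfin]
        exact le_iSup (fun x => ENNReal.ofReal (ellNorm p (fun i => partialD f i x))) x
      refine le_trans (measure_mono fun ω hω => ?_)
        (hdev2 n hn μ hμp hμ f hf Ω _ P X hX hind m hm t ht _ ENNReal.toReal_nonneg hL)
      rw [mem_ofPred_eq, ← ENNReal.ofReal_toReal hfin, ← ENNReal.ofReal_mul (by positivity),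
        ← ENNReal.ofReal_mul (by positivity)] at hω
      exact (ENNReal.ofReal_lt_ofReal_iff_of_nonneg (by positivity)).1 hω
    · rw [not_not] at hfin
      have htop : ENNReal.ofReal K₂ * gradLip p f *
          ENNReal.ofReal ((n : ℝ) ^ (1 / 2 - 1 / p) * t
            + (n : ℝ) ^ (1 / q) * t ^ 2 * Real.exp (t ^ 2 / (2 * q))) = ⊤ := by
        rw [hfin, ENNReal.mul_top (ENNReal.ofReal_pos.2 hK2).ne',
          ENNReal.top_mul (ENNReal.ofReal_pos.2 hS).ne']
      simp only [htop, not_top_lt, ofPred_false, measure_empty, zero_le]
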